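/- For each integer $d\ge 1$ let $S_d:F_d\to G_d$ be a nonzero compact linear operator between real separable Hilbert spaces, and let $\$:[0,\infty)\times\{1,2,\dots\}\to[1,\infty]$ be a cost function, where $\$(\sigma,d)$ is non-increasing in $\sigma$ and non-decreasing in $d$. Adaptive information $N$ about $f\in F_d$ consists of successive observations $y_i=L_i(f;y_1,\dots,y_{i-1})+e_i$, where $L_i(\cdot\,;y_1,\dots,y_{i-1})$ is a continuous linear functional on $F_d$ of norm at most $1$, and $e_i=\sigma_i(y_1,\dots,y_{i-1})\,\omega_i$ with precisions $\sigma_i(\cdot)\in[0,\infty)$ and independent standard Gaussian variables $\omega_1,\omega_2,\dots$ (Gaussian noise). The process terminates as soon as $(y_1,\dots,y_n)\in Y$, where $Y$ is a given set of finite sequences such that every infinite real sequence has exactly one initial segment (possibly the empty one) in $Y$; then $n=n(\mathbf y)$. All functions and sets involved in $N$ are measurable. An algorithm is a measurable map $\Phi:Y\to G_d$. Let $\pi_f$ be the distribution of $\mathbf y$ for given $f$, and put $$\mathrm{cost}(N)=\sup_{\|f\|\le 1}\int_Y\sum_{i=1}^{n(\mathbf y)}\$\big(\sigma_i(y_1,\dots,y_{i-1}),d\big)\,\pi_f(\mathrm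 d\mathbf y),\qquad \mathrm e(S_d,N,\Phi)=\sup_{\|f\|\le 1}\Big(\int_Y\|S_d(f)-\Phi(\mathbf y)\|^2\,\pi_f(\mathrm d\mathbf y)\Big)^{1/2}.$$ Let * $\mathrm{comp}^{\mathrm{wa}}_\$(\varepsilon,d)=\inf\{\mathrm{cost}(N):\ N,\Phi \text{ such that } \mathrm e(S_d,N,\Phi)\le\varepsilon\|S_d\|\}$; * $\mathrm n^{\mathrm w}(\varepsilon,d)$ be the complexity for exact information, i.e., the minimal number (in the worst case over $\|f\|\le 1$) of exact, adaptively chosen evaluations of functionals of norm at most $1$ from which $S_d(f)$ can be approximated with error at most $\varepsilon\|S_d\|$ for all $\|f\|\le1$; * $\widehat\$(\sigma,d)$ be the complexity of approximating a real parameter: the infimum of $\sup_{f\in\mathbb R}\int_Y\sum_{i=1}^{n(\mathbf y)}\$(\sigma_i,d)\,\pi_f(\mathrm d\mathbf y)$ over all adaptive information consisting of observations $y_i=f+e_i$ of $f\in\mathbb R$ itself, with Gaussian noise and adaptively chosen precisions $\sigma_i=\sigma_i(y_1,\dots,y_{i-1})$ and termination as above, and all measurable $\Phi:Y\to\mathbb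 R$, such that $\sup_{f\in\mathbb R}\big(\int_Y|f-\Phi(\mathbf y)|^2\,\pi_f(\mathrm d\mathbf y)\big)^{1/2}\le\sigma$. Then for all $\varepsilon\in(0,1)$ and $d\ge 1$, $$\mathrm{comp}^{\mathrm{wa}}_\$(\varepsilon,d)\ \ge\ \frac{\mathrm n^{\mathrm w}(2\varepsilon,d)+1}{4}.$$ Moreover, there is an absolute constant $c\in(0,1)$ such that for all $\varepsilon\in(0,c)$ and $d\ge1$, $$\mathrm{comp}^{\mathrm{wa}}_\$(\varepsilon,d)\ \ge\ \frac12\,\widehat\$\Big(\frac{\varepsilon}{c\sqrt2},d\Big).$$ -/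

import Mathlib

open MeasureTheory ProbabilityTheory
open scoped NNReal ENNReal

namespace NoisyInfo

/-- A cost function `$ : [0, ∞) × {1, 2, …} → [1, ∞]`: `cost σ d` is the price of one noisy
evaluation with precision `σ` in dimension `d`. It is non-decreasing in `σ⁻¹` and in `d`. -/
structure IsCostFunction (cost : ℝ≥0 → ℕ+ → ℝ≥0∞) : Prop where
  one_le : ∀ σ d, 1 ≤ cost σ d
  antitone_precision : ∀ d, Antitone fun σ => cost σ d
  monotone_dim : ∀ σ, Monotone fun d => cost σ d

/-- Adaptive information about elements of `F`. After the values `y₀, …, y_{i-1}` have been seen,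
the next functional is `L i y` (of norm at most one) and it is evaluated with precision `σ i y`.
The process stops as soon as the finite sequence of values is in the set `⋃ n, Y n` of all values
of information; every infinite real sequence has exactly one initial segment in this set. -/
structure AdaptiveInfo (F : Type*) [NormedAddCommGroup F] [NormedSpace ℝ F] where
  L : (i : ℕ) → (Fin i → ℝ) → (F →L[ℝ] ℝ)
  norm_L_le : ∀ i y, ‖L i y‖ ≤ 1
  σ : (i : ℕ) → (Fin i → ℝ) → ℝ≥0
  Y : (n : ℕ) → Set (Fin n → ℝ)
  existsUnique_mem : ∀ y : ℕ → ℝ, ∃! n : ℕ, (fun i : Fin n => y i) ∈ Y n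

namespace AdaptiveInfo

variable {F : Type*} [NormedAddCommGroup F] [NormedSpace ℝ F]

/-- The measurability needed for Gaussian noise. -/
structure IsMeasurable (N : AdaptiveInfo F) : Prop where
  measurable_L : ∀ i f, Measurable fun y => N.L i y f
  measurable_σ : ∀ i, Measurable (N.σ i)
  measurableSet_Y : ∀ n, MeasurableSet (N.Y n)

/-- The first `n` observations of `f` (termination disregarded) when the normalized noise is `ω`:
`yᵢ = Lᵢ(f; y₀, …, y_{i-1}) + σᵢ(y₀, …, y_{i-1}) ωᵢ`. -/
noncomputable def obs (N : AdaptiveInfo F) (f : F) (ω : ℕ → ℝ) : (n : ℕ) → Fin n → ℝ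
  | 0 => Fin.elim0
  | n + 1 => Fin.snoc (α := fun _ => ℝ) (obs N f ω n)
      (N.L n (obs N f ω n) f + (N.σ n (obs N f ω n) : ℝ) * ω n)

theorem obs_eq (N : AdaptiveInfo F) (f : F) (ω : ℕ → ℝ) (n : ℕ) :
    N.obs f ω n = fun i : Fin n => N.obs f ω (i + 1) (Fin.last i) := by
  induction n with
  | zero => funext i; exact i.elim0
  | succ n ih =>
    funext i
    refine Fin.lastCases ?_ (fun j => ?_) i
    · rfl
    · have h : N.obs f ω (n + 1) j.castSucc = N.obs f ω n j := by
        simp [obs]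
      rw [h]
      exact congrFun ih j

theorem existsUnique_obs_mem (N : AdaptiveInfo F) (f : F) (ω : ℕ → ℝ) :
    ∃! n : ℕ, N.obs f ω n ∈ N.Y n := by
  have h := N.existsUnique_mem fun i => N.obs f ω (i + 1) (Fin.last i)
  simpa only [← N.obs_eq f ω] using h

/-- The number `n(y)` of observations made before termination. -/
noncomputable def numObs (N : AdaptiveInfo F) (f : F) (ω : ℕ → ℝ) : ℕ :=
  (N.existsUnique_obs_mem f ω).choose

/-- The information is exact: all evaluations are made without noise. -/
def IsExact (N : AdaptiveInfo F) : Prop := ∀ i y, N.σ i y = 0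

end AdaptiveInfo

/-- An algorithm maps finite sequences of observations to elements of `G`
(only its values on the set of all values of information matter). -/
abbrev Algorithm (G : Type*) := (n : ℕ) → (Fin n → ℝ) → G

/-- The law of a sequence of independent standard Gaussian variables. -/
noncomputable def stdNoise : Measure (ℕ → ℝ) := Measure.infinitePi fun _ => gaussianReal 0 1

section Settings

variable {F G : Type*} [NormedAddCommGroup F] [NormedSpace ℝ F]
  [NormedAddCommGroup G] [NormedSpace ℝ G]

/-- The output of the algorithm `Φ` using information `N` for the instance `f` and noise `ω`. -/
noncomputable def output (N : AdaptiveInfo F) (Φ : Algorithm G) (f : F) (ω : ℕ → ℝ) : G :=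
  Φ (N.numObs f ω) (N.obs f ω (N.numObs f ω))

/-- Gaussian noise: the worst (over `f ∈ K`) expected total cost of the information `N`. -/
noncomputable def costWA (cost : ℝ≥0 → ℝ≥0∞) (K : Set F) (N : AdaptiveInfo F) : ℝ≥0∞ :=
  ⨆ f ∈ K, ∫⁻ ω, ∑ i ∈ Finset.range (N.numObs f ω), cost (N.σ i (N.obs f ω i)) ∂stdNoise

/-- Gaussian noise: the worst (over `f ∈ K`) root mean square error of `Φ` using `N`. -/
noncomputable def errWA (S : F →L[ℝ] G) (K : Set F) (N : AdaptiveInfo F) (Φ : Algorithm G) :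
    ℝ≥0∞ :=
  ⨆ f ∈ K, (∫⁻ ω, ‖S f - output N Φ f ω‖ₑ ^ 2 ∂stdNoise) ^ (1 / 2 : ℝ)

/-- The information `ε`-complexity of `S` for Gaussian noise, over the unit ball of `F`, with
the normalized error. -/
noncomputable def compWA (cost : ℝ≥0 → ℝ≥0∞) (S : F →L[ℝ] G) (ε : ℝ≥0) : ℝ≥0∞ :=
  sInf {a | ∃ (N : AdaptiveInfo F) (Φ : Algorithm G),
    N.IsMeasurable ∧ (∀ n, StronglyMeasurable (Φ n)) ∧
    errWA S (Metric.closedBall 0 1) N Φ ≤ ε * ‖S‖ₑ ∧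
    a = costWA cost (Metric.closedBall 0 1) N}

/-- The worst case `ε`-complexity of `S` for exact information: the minimal (worst case) number of
exact evaluations of functionals of norm at most one, chosen adaptively, which allow to approximate
`S` on the unit ball of `F` with error at most `ε ‖S‖`. With exact information the noise variable
is irrelevant, and it is put equal to zero. -/
noncomputable def nWorst (S : F →L[ℝ] G) (ε : ℝ≥0) : ℝ≥0∞ :=
  sInf {a | ∃ (N : AdaptiveInfo F) (Φ : Algorithm G), N.IsExact ∧
    (⨆ f ∈ Metric.closedBall (0 : F) 1, ‖S f - output N Φ f 0‖ₑ) ≤ ε * ‖S‖ₑ ∧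
    a = ⨆ f ∈ Metric.closedBall (0 : F) 1, (N.numObs f 0 : ℝ≥0∞)}

end Settings

/-- The auxiliary cost function: the complexity, for Gaussian noise, of approximating a real
parameter `f`, ranging over the whole line, with root mean square error at most `σ`, from noisy
observations of `f` itself with adaptively chosen precisions. -/
noncomputable def auxCost (cost : ℝ≥0 → ℕ+ → ℝ≥0∞) (σ : ℝ≥0) (d : ℕ+) : ℝ≥0∞ :=
  sInf {a | ∃ (N : AdaptiveInfo ℝ) (Φ : Algorithm ℝ),
    (∀ i y, N.L i y = ContinuousLinearMap.id ℝ ℝ) ∧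
    N.IsMeasurable ∧ (∀ n, StronglyMeasurable (Φ n)) ∧
    errWA (ContinuousLinearMap.id ℝ ℝ) Set.univ N Φ ≤ σ ∧
    a = costWA (fun s => cost s d) Set.univ N}

end NoisyInfo

/-! ### Measurability of the observation process -/

namespace NoisyInfo

namespace AdaptiveInfo

section

variable {F : Type*} [NormedAddCommGroup F] [NormedSpace ℝ F]

/-! The two bounds have independent proofs: the first counts observations, the second measures their
precision. Throughout, `C` is the cost of the given information.

Counting. For a fixed noise the information is an exact adaptive strategy. On an `m`-dimensional
subspace with `‖S f‖ ≥ s ‖f‖` its observations cut the unit ball into affine slices of dimension at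
least `m - n(f)`, on which the output is constant. By central symmetry, the squared error integrated
over a slice is at least `s²` times the second moment of the slice about its centre, and for a
`d`-dimensional slice this moment is `d/2` times the integral of `w(f) = (1 - ‖f‖²)₊`. Hence `s² ∫
(m - n) w ≤ 2 ∫ error²` (`slice_tradeoff`). Averaging over the noise with `s = 2ε‖S‖` gives `4m ≤ m
+ 2 + 4C` (`le_costWA_of_isometry`). Compactness provides singular vectors spanning such a subspace;
if there are fewer than `m` of them, their exact coefficients already solve the problem to accuracy
`2ε` (`nWorst_le_of_orthonormal`).

Precision. Take `±f` with `‖f‖ ≤ 8ε` and `‖S f‖ ≥ 4ε‖S‖`. An accurate algorithm must tell them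
apart. Under Gaussian noise the squared probability of an event for `f` is at most `exp (h² J)`
times its probability for `-f`, where `h` bounds the differences of the observed functionals and `J`
bounds `∑ σᵢ⁻²` on the event (`sq_stdNoise_le_exp_mul`). So not every path of cost at most `2C` can
have `∑ σᵢ⁻² ≤ 1/(256 ε²)` (`exists_cheap_precise_path`). The precisions of one exceptional path,
used nonadaptively for a real parameter, give a weighted mean of error at most a multiple of `ε` at
cost at most `2C`. -/

theorem obs_numObs_mem (N : AdaptiveInfo F) (f : F) (ω : ℕ → ℝ) :
    N.obs f ω (N.numObs f ω) ∈ N.Y (N.numObs f ω) :=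
  (N.existsUnique_obs_mem f ω).choose_spec.1

theorem numObs_eq_of_mem (N : AdaptiveInfo F) {f : F} {ω : ℕ → ℝ} {n : ℕ}
    (h : N.obs f ω n ∈ N.Y n) : N.numObs f ω = n :=
  ((N.existsUnique_obs_mem f ω).choose_spec.2 n h).symm

theorem numObs_eq_iff (N : AdaptiveInfo F) {f : F} {ω : ℕ → ℝ} {n : ℕ} :
    N.numObs f ω = n ↔ N.obs f ω n ∈ N.Y n :=
  ⟨fun h => h ▸ N.obs_numObs_mem f ω, N.numObs_eq_of_mem⟩

/-- Joint measurability of the observations in a parameter that determines both the instance and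
the noise. -/
theorem measurable_obs {N : AdaptiveInfo F} (hN : N.IsMeasurable) {X : Type*} [MeasurableSpace X]
    {f : X → F} {w : X → ℕ → ℝ} (hw : Measurable w)
    (hf : ∀ i, Measurable fun q : X × (Fin i → ℝ) => N.L i q.2 (f q.1)) (n : ℕ) :
    Measurable fun p => N.obs (f p) (w p) n := by
  induction n with
  | zero => exact measurable_pi_iff.2 fun i => i.elim0
  | succ n ih =>
    refine measurable_pi_iff.2 fun i => ?_
    refine Fin.lastCases ?_ (fun j => ?_) i
    · simp only [obs, Fin.snoc_last]
      have h1 : Measurable fun p => N.L n (N.obs (f p) (w p) n) (f p) :=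
        (hf n).comp (measurable_id.prodMk ih)
      have h2 : Measurable fun p => (N.σ n (N.obs (f p) (w p) n) : ℝ) :=
        ((hN.measurable_σ n).comp ih).coe_nnreal_real
      exact h1.add (h2.mul ((measurable_pi_apply n).comp hw))
    · simp only [obs, Fin.snoc_castSucc]
      exact (measurable_pi_apply j).comp ih

theorem measurable_numObs {N : AdaptiveInfo F} (hN : N.IsMeasurable) {X : Type*}
    [MeasurableSpace X] {f : X → F} {w : X → ℕ → ℝ} (hw : Measurable w)
    (hf : ∀ i, Measurable fun q : X × (Fin i → ℝ) => N.L i q.2 (f q.1)) :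
    Measurable fun p => N.numObs (f p) (w p) := by
  refine measurable_to_countable' fun n => ?_
  have : (fun p => N.numObs (f p) (w p)) ⁻¹' {n} = (fun p => N.obs (f p) (w p) n) ⁻¹' N.Y n := by
    ext p
    exact N.numObs_eq_iff
  rw [this]
  exact measurable_obs hN hw hf n (hN.measurableSet_Y n)

theorem measurable_numObs_comp {N : AdaptiveInfo F} (hN : N.IsMeasurable) {X β : Type*}
    [MeasurableSpace X] [MeasurableSpace β] {f : X → F} {w : X → ℕ → ℝ} (hw : Measurable w)
    (hf : ∀ i, Measurable fun q : X × (Fin i → ℝ) => N.L i q.2 (f q.1))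
    {u : ℕ → X → β} (hu : ∀ n, Measurable (u n)) :
    Measurable fun p => u (N.numObs (f p) (w p)) p := by
  have h : Measurable fun q : X × ℕ => u q.2 q.1 := measurable_from_prod_countable_left hu
  exact h.comp (measurable_id.prodMk (measurable_numObs hN hw hf))

theorem measurable_eval_const {N : AdaptiveInfo F} (hN : N.IsMeasurable) {X : Type*}
    [MeasurableSpace X] (f : F) (i : ℕ) :
    Measurable fun q : X × (Fin i → ℝ) => N.L i q.2 f :=
  (hN.measurable_L i f).comp measurable_snd

/-- `N.L i y f` is assumed measurable in `y` only for each fixed `f`. On a finite-dimensional affine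
family, linearity in `f` reduces joint measurability to finitely many fixed instances. -/
theorem measurable_eval_affine {N : AdaptiveInfo F} (hN : N.IsMeasurable) {X : Type*}
    [MeasurableSpace X] {d : ℕ} (v : F) (A : EuclideanSpace ℝ (Fin d) →ₗ[ℝ] F)
    {x : X → EuclideanSpace ℝ (Fin d)} (hx : Measurable x) (i : ℕ) :
    Measurable fun q : X × (Fin i → ℝ) => N.L i q.2 (v + A (x q.1)) := by
  have h : ∀ q : X × (Fin i → ℝ), N.L i q.2 (v + A (x q.1)) =
      N.L i q.2 v + ∑ j, x q.1 j * N.L i q.2 (A (EuclideanSpace.basisFun (Fin d) ℝ j)) := by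
    intro q
    rw [map_add]
    congr 1
    conv_lhs => rw [← (EuclideanSpace.basisFun (Fin d) ℝ).sum_repr (x q.1)]
    simp [map_sum]
  simp only [h]
  refine (measurable_eval_const hN v i).add (Finset.measurable_sum _ fun j _ => ?_)
  refine Measurable.mul ?_ (measurable_eval_const hN _ i)
  have : Measurable fun z : EuclideanSpace ℝ (Fin d) => z j := by fun_prop
  exact this.comp (hx.comp measurable_fst)

/-- The first observations of `f` form an initial segment of the later ones. -/
theorem obs_castLE (N : AdaptiveInfo F) (f : F) (ω : ℕ → ℝ) {n k : ℕ} (h : n ≤ k) :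
    (fun i : Fin n => N.obs f ω k (Fin.castLE h i)) = N.obs f ω n := by
  rw [N.obs_eq f ω k, N.obs_eq f ω n]
  rfl

end

end AdaptiveInfo

theorem measurable_enorm_sub_output {F G : Type*} [NormedAddCommGroup F] [NormedSpace ℝ F]
    [NormedAddCommGroup G] {N : AdaptiveInfo F} (hN : N.IsMeasurable) {Φ : Algorithm G}
    (hΦ : ∀ n, StronglyMeasurable (Φ n)) {X : Type*} [MeasurableSpace X] {f : X → F}
    {w : X → ℕ → ℝ} (hw : Measurable w)
    (hf : ∀ i, Measurable fun q : X × (Fin i → ℝ) => N.L i q.2 (f q.1)) {g : X → G}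
    (hg : StronglyMeasurable g) :
    Measurable fun p => ‖g p - output N Φ (f p) (w p)‖ₑ := by
  refine AdaptiveInfo.measurable_numObs_comp hN hw hf
    (u := fun n p => ‖g p - Φ n (N.obs (f p) (w p) n)‖ₑ) fun n => ?_
  exact (hg.sub ((hΦ n).comp_measurable (AdaptiveInfo.measurable_obs hN hw hf n))).enorm

section

variable {F G : Type*} [NormedAddCommGroup F] [NormedSpace ℝ F]
  [NormedAddCommGroup G] [NormedSpace ℝ G]

instance : IsProbabilityMeasure stdNoise := by
  unfold stdNoise
  infer_instance

/-- The error bound, for a single instance and without the square root. -/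
theorem lintegral_sq_le_of_errWA_le {S : F →L[ℝ] G} {K : Set F} {N : AdaptiveInfo F}
    {Φ : Algorithm G} {r : ℝ≥0∞} (h : errWA S K N Φ ≤ r) {f : F} (hf : f ∈ K) :
    ∫⁻ ω, ‖S f - output N Φ f ω‖ₑ ^ 2 ∂stdNoise ≤ r ^ 2 := by
  have h1 : (∫⁻ ω, ‖S f - output N Φ f ω‖ₑ ^ 2 ∂stdNoise) ^ (1 / 2 : ℝ) ≤ r :=
    le_trans (le_iSup₂ (f := fun f (_ : f ∈ K) =>
      (∫⁻ ω, ‖S f - output N Φ f ω‖ₑ ^ 2 ∂stdNoise) ^ (1 / 2 : ℝ)) f hf) h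
  have h2 := ENNReal.rpow_le_rpow h1 (z := 2) (by norm_num)
  rw [← ENNReal.rpow_mul] at h2
  simpa using h2

theorem lintegral_le_costWA (cost : ℝ≥0 → ℝ≥0∞) (K : Set F) (N : AdaptiveInfo F) {f : F}
    (hf : f ∈ K) :
    ∫⁻ ω, ∑ i ∈ Finset.range (N.numObs f ω), cost (N.σ i (N.obs f ω i)) ∂stdNoise
      ≤ costWA cost K N :=
  le_iSup₂ (f := fun f (_ : f ∈ K) =>
    ∫⁻ ω, ∑ i ∈ Finset.range (N.numObs f ω), cost (N.σ i (N.obs f ω i)) ∂stdNoise) f hf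

theorem lintegral_numObs_le_costWA {cost : ℝ≥0 → ℝ≥0∞} (hc : ∀ σ, 1 ≤ cost σ) {K : Set F}
    (N : AdaptiveInfo F) {f : F} (hf : f ∈ K) :
    ∫⁻ ω, (N.numObs f ω : ℝ≥0∞) ∂stdNoise ≤ costWA cost K N := by
  refine (lintegral_mono fun ω => ?_).trans (lintegral_le_costWA cost K N hf)
  calc (N.numObs f ω : ℝ≥0∞) = ∑ i ∈ Finset.range (N.numObs f ω), (1 : ℝ≥0∞) := by simp
    _ ≤ _ := Finset.sum_le_sum fun i _ => hc _

end

end NoisyInfo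

namespace NoisyInfo

/-! ### Moments of Euclidean balls -/

section Ball

/-- Insertion of a coordinate at position `i`. -/
noncomputable def insertCoord {d : ℕ} (i : Fin (d + 1)) (p : ℝ × EuclideanSpace ℝ (Fin d)) :
    EuclideanSpace ℝ (Fin (d + 1)) :=
  WithLp.toLp 2 (i.insertNth (α := fun _ => ℝ) p.1 p.2)

theorem measurePreserving_insertCoord {d : ℕ} (i : Fin (d + 1)) :
    MeasurePreserving (insertCoord i) (volume.prod volume) volume := by
  have h1 := (volume_preserving_piFinSuccAbove (fun _ : Fin (d + 1) => ℝ) i).symm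
  have h2 : MeasurePreserving (Prod.map id (WithLp.ofLp (p := 2)) :
      ℝ × EuclideanSpace ℝ (Fin d) → ℝ × (Fin d → ℝ)) (volume.prod volume)
      (volume.prod volume) :=
    (MeasurePreserving.id volume).prod (PiLp.volume_preserving_ofLp (Fin d))
  exact (PiLp.volume_preserving_toLp (Fin (d + 1))).comp (h1.comp h2)

theorem norm_sq_insertCoord {d : ℕ} (i : Fin (d + 1)) (p : ℝ × EuclideanSpace ℝ (Fin d)) :
    ‖insertCoord i p‖ ^ 2 = p.1 ^ 2 + ‖p.2‖ ^ 2 := by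
  rw [EuclideanSpace.real_norm_sq_eq, EuclideanSpace.real_norm_sq_eq, Fin.sum_univ_succAbove _ i]
  simp [insertCoord]

theorem insertCoord_apply {d : ℕ} (i : Fin (d + 1)) (p : ℝ × EuclideanSpace ℝ (Fin d)) :
    insertCoord i p i = p.1 := by
  simp [insertCoord]

/-- For `r = a²` both sides equal `4a³/3`; for negative `r` both vanish, because `ENNReal.ofReal`
takes the positive part. Arbitrary real `r` allows for the empty line sections of a ball. -/
theorem lintegral_sq_interval (r : ℝ) :
    2 * ∫⁻ t : ℝ in {t | t ^ 2 ≤ r}, ENNReal.ofReal (t ^ 2) = ∫⁻ t : ℝ, ENNReal.ofReal (r - t ^ 2) := by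
  rcases lt_or_ge r 0 with hr | hr
  · have h1 : {t : ℝ | t ^ 2 ≤ r} = ∅ := by
      ext t
      simp only [Set.mem_ofPred_eq, Set.mem_empty_iff_false, iff_false, not_le]
      nlinarith [sq_nonneg t]
    have h2 : ∀ t : ℝ, ENNReal.ofReal (r - t ^ 2) = 0 := fun t =>
      ENNReal.ofReal_eq_zero.2 (by nlinarith [sq_nonneg t])
    simp [h1, h2]
  · set a := Real.sqrt r with ha
    have ha0 : 0 ≤ a := Real.sqrt_nonneg r
    have har : a ^ 2 = r := Real.sq_sqrt hr
    have h1 : {t : ℝ | t ^ 2 ≤ r} = Set.Icc (-a) a := by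
      ext t
      rw [Set.mem_ofPred_eq, ← har, sq_le_sq, abs_of_nonneg ha0, Set.mem_Icc, abs_le]
    have h2 : ∫⁻ t : ℝ, ENNReal.ofReal (r - t ^ 2)
        = ∫⁻ t : ℝ in Set.Icc (-a) a, ENNReal.ofReal (r - t ^ 2) := by
      rw [← lintegral_indicator measurableSet_Icc]
      refine lintegral_congr fun t => ?_
      by_cases ht : t ∈ Set.Icc (-a) a
      · rw [Set.indicator_of_mem ht]
      · rw [Set.indicator_of_notMem ht, ENNReal.ofReal_eq_zero]
        rw [← h1, Set.mem_ofPred_eq] at ht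
        linarith
    have hi1 : IntegrableOn (fun t : ℝ => t ^ 2) (Set.Icc (-a) a) :=
      (by fun_prop : Continuous fun t : ℝ => t ^ 2).continuousOn.integrableOn_Icc
    have hi2 : IntegrableOn (fun t : ℝ => r - t ^ 2) (Set.Icc (-a) a) :=
      (by fun_prop : Continuous fun t : ℝ => r - t ^ 2).continuousOn.integrableOn_Icc
    rw [h2, h1, ← ofReal_integral_eq_lintegral_ofReal hi1 (ae_of_all _ fun t => sq_nonneg t),
      ← ofReal_integral_eq_lintegral_ofReal hi2, ← ENNReal.ofReal_ofNat,
      ← ENNReal.ofReal_mul (by norm_num)]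
    · congr 1
      rw [integral_Icc_eq_integral_Ioc, integral_Icc_eq_integral_Ioc,
        ← intervalIntegral.integral_of_le (by linarith), ← intervalIntegral.integral_of_le (by linarith),
        intervalIntegral.integral_sub (by simp) (by simp)]
      simp only [integral_pow, intervalIntegral.integral_const, smul_eq_mul]
      rw [← har]
      push_cast
      ring
    · refine (ae_restrict_iff' measurableSet_Icc).2 (ae_of_all _ fun t ht => ?_)
      rw [← h1, Set.mem_ofPred_eq] at ht
      simpa using ht

theorem measurableSet_norm_sq_le (d : ℕ) (r : ℝ) :
    MeasurableSet {x : EuclideanSpace ℝ (Fin d) | ‖x‖ ^ 2 ≤ r} :=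
  measurableSet_le (by fun_prop) measurable_const

/-- Fubini along the `i`-th axis: on the line through `z` the one-dimensional identity applies with
`r - ‖z‖²`. -/
theorem lintegral_sq_coord_ball {d : ℕ} (i : Fin d) (r : ℝ) :
    2 * ∫⁻ x : EuclideanSpace ℝ (Fin d) in {x | ‖x‖ ^ 2 ≤ r}, ENNReal.ofReal (x i ^ 2)
      = ∫⁻ x : EuclideanSpace ℝ (Fin d), ENNReal.ofReal (r - ‖x‖ ^ 2) := by
  obtain _ | d := d
  · exact i.elim0
  have hm1 : Measurable fun x : EuclideanSpace ℝ (Fin (d + 1)) =>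
      Set.indicator {x | ‖x‖ ^ 2 ≤ r} (fun x => ENNReal.ofReal (x i ^ 2)) x :=
    Measurable.indicator (by fun_prop) (measurableSet_norm_sq_le _ r)
  have hm2 : Measurable fun x : EuclideanSpace ℝ (Fin (d + 1)) => ENNReal.ofReal (r - ‖x‖ ^ 2) := by
    fun_prop
  have hp := measurePreserving_insertCoord i
  have hm1' : Measurable fun p => Set.indicator {x | ‖x‖ ^ 2 ≤ r}
      (fun x => ENNReal.ofReal (x i ^ 2)) (insertCoord i p) := hm1.comp hp.measurable
  have hm2' : Measurable fun p => ENNReal.ofReal (r - ‖insertCoord i p‖ ^ 2) :=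
    hm2.comp hp.measurable
  rw [← lintegral_indicator (measurableSet_norm_sq_le _ r), ← hp.lintegral_comp hm1,
    ← hp.lintegral_comp hm2, lintegral_prod_symm' _ hm1',
    lintegral_prod_symm' _ hm2', ← lintegral_const_mul]
  · refine lintegral_congr fun z => ?_
    have hset : MeasurableSet {t : ℝ | t ^ 2 ≤ r - ‖z‖ ^ 2} :=
      measurableSet_le (by fun_prop) measurable_const
    calc _ = 2 * ∫⁻ t : ℝ in {t | t ^ 2 ≤ r - ‖z‖ ^ 2}, ENNReal.ofReal (t ^ 2) := by
          rw [← lintegral_indicator hset]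
          congr 1
          refine lintegral_congr fun t => ?_
          simp only [Set.indicator, Set.mem_ofPred_eq, norm_sq_insertCoord, insertCoord_apply,
            le_sub_iff_add_le]
      _ = _ := by
          rw [lintegral_sq_interval]
          refine lintegral_congr fun t => ?_
          simp only [norm_sq_insertCoord]
          congr 1
          ring
  · exact Measurable.lintegral_prod_left' hm1'

/-- This identity is the reason for the weight `(r - ‖x‖²)₊`: relative to it, the second moment of a
slice depends on the dimension alone, not on the radius. -/
theorem lintegral_norm_sq_ball (d : ℕ) (r : ℝ) :
    2 * ∫⁻ x : EuclideanSpace ℝ (Fin d) in {x | ‖x‖ ^ 2 ≤ r}, ENNReal.ofReal (‖x‖ ^ 2)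
      = d * ∫⁻ x : EuclideanSpace ℝ (Fin d), ENNReal.ofReal (r - ‖x‖ ^ 2) := by
  have h : ∀ x : EuclideanSpace ℝ (Fin d),
      ENNReal.ofReal (‖x‖ ^ 2) = ∑ i, ENNReal.ofReal (x i ^ 2) := fun x => by
    rw [EuclideanSpace.real_norm_sq_eq, ENNReal.ofReal_sum_of_nonneg fun i _ => sq_nonneg _]
  simp_rw [h]
  rw [lintegral_finsetSum _ fun i _ => by fun_prop, Finset.mul_sum]
  simp_rw [lintegral_sq_coord_ball]
  simp

theorem setOf_norm_sq_le_one (d : ℕ) :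
    {x : EuclideanSpace ℝ (Fin d) | ‖x‖ ^ 2 ≤ 1} = Metric.closedBall 0 1 := by
  ext x
  simp

/-- Integrate `1 = ‖x‖² + (1 - ‖x‖²)` over the ball. This converts the unweighted error bound into
the weight used for counting observations. -/
theorem volume_ball_eq (d : ℕ) :
    2 * volume {x : EuclideanSpace ℝ (Fin d) | ‖x‖ ^ 2 ≤ 1}
      = (d + 2) * ∫⁻ x : EuclideanSpace ℝ (Fin d), ENNReal.ofReal (1 - ‖x‖ ^ 2) := by
  have hs := measurableSet_norm_sq_le d 1
  have h1 : ∫⁻ x : EuclideanSpace ℝ (Fin d), ENNReal.ofReal (1 - ‖x‖ ^ 2)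
      = ∫⁻ x : EuclideanSpace ℝ (Fin d) in {x | ‖x‖ ^ 2 ≤ 1}, ENNReal.ofReal (1 - ‖x‖ ^ 2) := by
    rw [← lintegral_indicator hs]
    refine lintegral_congr fun x => ?_
    by_cases hx : ‖x‖ ^ 2 ≤ 1
    · rw [Set.indicator_of_mem (by exact hx)]
    · rw [Set.indicator_of_notMem (by exact hx), ENNReal.ofReal_eq_zero]
      linarith
  have h2 : volume {x : EuclideanSpace ℝ (Fin d) | ‖x‖ ^ 2 ≤ 1}
      = (∫⁻ x : EuclideanSpace ℝ (Fin d) in {x | ‖x‖ ^ 2 ≤ 1}, ENNReal.ofReal (‖x‖ ^ 2))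
        + ∫⁻ x : EuclideanSpace ℝ (Fin d), ENNReal.ofReal (1 - ‖x‖ ^ 2) := by
    rw [h1, ← lintegral_add_left (by fun_prop), ← setLIntegral_one]
    refine setLIntegral_congr_fun hs fun x hx => ?_
    have hx' : ‖x‖ ^ 2 ≤ 1 := hx
    rw [← ENNReal.ofReal_add (sq_nonneg _) (by linarith)]
    simp
  rw [h2, mul_add, lintegral_norm_sq_ball, add_mul]

theorem lintegral_ball_weight_ne_top (d : ℕ) :
    ∫⁻ x : EuclideanSpace ℝ (Fin d), ENNReal.ofReal (1 - ‖x‖ ^ 2) ≠ ∞ := by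
  have h := volume_ball_eq d
  intro hT
  rw [hT, setOf_norm_sq_le_one] at h
  have h3 : (2 : ℝ≥0∞) * volume (Metric.closedBall (0 : EuclideanSpace ℝ (Fin d)) 1) ≠ ∞ :=
    ENNReal.mul_ne_top (by simp) measure_closedBall_lt_top.ne
  apply h3
  rw [h, ENNReal.mul_top]
  simp

theorem lintegral_ball_weight_ne_zero (d : ℕ) :
    ∫⁻ x : EuclideanSpace ℝ (Fin d), ENNReal.ofReal (1 - ‖x‖ ^ 2) ≠ 0 := by
  have h := volume_ball_eq d
  intro hT
  rw [hT, setOf_norm_sq_le_one, mul_zero] at h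
  have h3 : 0 < volume (Metric.closedBall (0 : EuclideanSpace ℝ (Fin d)) 1) :=
    Metric.measure_closedBall_pos _ _ one_pos
  simp [h3.ne'] at h

end Ball

end NoisyInfo

namespace NoisyInfo

/-! ### Cutting a slice along a functional -/

section Slicing

variable {F G : Type*} [NormedAddCommGroup F] [InnerProductSpace ℝ F]
  [NormedAddCommGroup G] [InnerProductSpace ℝ G]

/-- Rotate the first basis vector to the direction of the Riesz representative of `g`. -/
theorem exists_rotation_eq_coord {d : ℕ} (g : EuclideanSpace ℝ (Fin (d + 1)) →L[ℝ] ℝ) :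
    ∃ (R : EuclideanSpace ℝ (Fin (d + 1)) ≃ₗᵢ[ℝ] EuclideanSpace ℝ (Fin (d + 1))) (c : ℝ),
      ∀ x, g (R x) = c * x 0 := by
  set w := (InnerProductSpace.toDual ℝ _).symm g with hw
  have hg : ∀ x, g x = inner ℝ w x := fun x => by
    rw [hw, InnerProductSpace.toDual_symm_apply]
  by_cases hw0 : w = 0
  · exact ⟨LinearIsometryEquiv.refl ℝ _, 0, fun x => by simp [hg, hw0]⟩
  · have hon : Orthonormal ℝ (({0} : Set (Fin (d + 1))).domRestrict
        (fun _ => ‖w‖⁻¹ • w)) := by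
      rw [orthonormal_iff_ite]
      rintro ⟨i, hi⟩ ⟨j, hj⟩
      obtain rfl : i = 0 := hi
      obtain rfl : j = 0 := hj
      have : ‖w‖ ≠ 0 := norm_ne_zero_iff.2 hw0
      simp [norm_smul, this]
    obtain ⟨b, hb⟩ := hon.exists_orthonormalBasis_extension_of_card_eq (by simp)
    refine ⟨b.repr.symm, ‖w‖, fun x => ?_⟩
    have h0 : w = ‖w‖ • b 0 := by
      rw [hb 0 rfl, smul_smul, mul_inv_cancel₀ (norm_ne_zero_iff.2 hw0), one_smul]
    rw [hg]
    conv_lhs => rw [h0]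
    rw [real_inner_smul_left, ← b.repr_apply_apply, LinearIsometryEquiv.apply_symm_apply]

theorem insertCoord_eq_add {d : ℕ} (i : Fin (d + 1)) (p : ℝ × EuclideanSpace ℝ (Fin d)) :
    insertCoord i p = insertCoord i (p.1, 0) + insertCoord i (0, p.2) := by
  ext j
  refine Fin.succAboveCases i ?_ (fun j => ?_) j <;> simp [insertCoord]

/-- Insertion of a zero coordinate, as a linear isometry. -/
noncomputable def insertZero {d : ℕ} (i : Fin (d + 1)) :
    EuclideanSpace ℝ (Fin d) →ₗᵢ[ℝ] EuclideanSpace ℝ (Fin (d + 1)) where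
  toFun z := insertCoord i (0, z)
  map_add' x y := by
    ext j
    refine Fin.succAboveCases i ?_ (fun j => ?_) j <;> simp [insertCoord]
  map_smul' c x := by
    ext j
    refine Fin.succAboveCases i ?_ (fun j => ?_) j <;> simp [insertCoord]
  norm_map' x := by
    have h := norm_sq_insertCoord i (0, x)
    have : ‖insertCoord i (0, x)‖ ^ 2 = ‖x‖ ^ 2 := by simpa using h
    exact (sq_eq_sq₀ (norm_nonneg _) (norm_nonneg _)).1 this

theorem inner_insertCoord {d : ℕ} (i : Fin (d + 1)) (t : ℝ) (z : EuclideanSpace ℝ (Fin d)) :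
    inner ℝ (insertCoord i (t, 0)) (insertCoord i (0, z)) = 0 := by
  rw [PiLp.inner_apply, Fin.sum_univ_succAbove _ i]
  simp [insertCoord]

/-- A ball in an affine slice is cut along the level sets of a functional. -/
theorem exists_slicing {d : ℕ} (v : F) (A : EuclideanSpace ℝ (Fin (d + 1)) →ₗᵢ[ℝ] F)
    (hv : ∀ x, inner ℝ v (A x) = 0) (l : F →L[ℝ] ℝ) :
    ∃ (v' : ℝ → F) (A' : EuclideanSpace ℝ (Fin d) →ₗᵢ[ℝ] F) (c : ℝ),
      (∀ t z, ∃ x, v' t + A' z = v + A x) ∧ (∀ z, ∃ x, A' z = A x ∧ ‖x‖ = ‖z‖) ∧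
      (∀ t z, inner ℝ (v' t) (A' z) = 0) ∧ (∀ t z, l (v' t + A' z) = l v + c * t) ∧
      ∀ φ : F → ℝ≥0∞, Measurable (fun x => φ (v + A x)) →
        Measurable (fun t => ∫⁻ z, φ (v' t + A' z)) ∧
        ∫⁻ x, φ (v + A x) = ∫⁻ t, ∫⁻ z, φ (v' t + A' z) := by
  -- After this rotation `l` depends at most on the first coordinate, so the pieces are `x 0 = t`
  -- and the integral splits by Fubini. Base points stay orthogonal to the directions, which keeps
  -- Pythagoras available after every cut.
  obtain ⟨R, c, hc⟩ := exists_rotation_eq_coord (l.comp A.toContinuousLinearMap)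
  have hc' : ∀ x, l (A (R x)) = c * x 0 := hc
  have hsum : ∀ t z, v + A (R (insertCoord 0 (t, 0))) + A (R (insertCoord 0 (0, z)))
      = v + A (R (insertCoord 0 (t, z))) := fun t z => by
    rw [insertCoord_eq_add 0 (t, z), map_add, map_add, add_assoc]
  refine ⟨fun t => v + A (R (insertCoord 0 (t, 0))),
    A.comp (R.toLinearIsometry.comp (insertZero 0)), c, fun t z => ⟨R (insertCoord 0 (t, z)), ?_⟩,
    fun z => ⟨R (insertCoord 0 (0, z)), rfl, ?_⟩, fun t z => ?_, fun t z => ?_, fun φ hφ => ?_⟩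
  · exact hsum t z
  · rw [R.norm_map]
    exact (insertZero 0).norm_map z
  · change inner ℝ (v + A (R (insertCoord 0 (t, 0)))) (A (R (insertCoord 0 (0, z)))) = 0
    rw [inner_add_left, hv, zero_add, A.inner_map_map, R.inner_map_map, inner_insertCoord]
  · change l (v + A (R (insertCoord 0 (t, 0))) + A (R (insertCoord 0 (0, z)))) = _
    rw [hsum, map_add, hc', insertCoord_apply]
  · have hp := (R.measurePreserving).comp (measurePreserving_insertCoord (d := d) 0)
    have hm : Measurable fun p : ℝ × EuclideanSpace ℝ (Fin d) =>
        φ (v + A (R (insertCoord 0 p))) := hφ.comp hp.measurable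
    have heq : ∀ t, ∫⁻ z, φ (v + A (R (insertCoord 0 (t, 0))) +
        (A.comp (R.toLinearIsometry.comp (insertZero 0))) z)
        = ∫⁻ z, φ (v + A (R (insertCoord 0 (t, z)))) := fun t =>
      lintegral_congr fun z => congrArg φ (hsum t z)
    simp only [heq]
    refine ⟨hm.lintegral_prod_right', ?_⟩
    rw [← hp.lintegral_comp hφ]
    exact lintegral_prod _ hm.aemeasurable

end Slicing

/-! ### The trade-off between error and number of observations -/

section FixedNoise

variable {F G : Type*} [NormedAddCommGroup F] [InnerProductSpace ℝ F]
  [NormedAddCommGroup G] [InnerProductSpace ℝ G]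

theorem two_mul_enorm_sq_le (a b : G) :
    2 * ‖b‖ₑ ^ 2 ≤ ‖a + b‖ₑ ^ 2 + ‖a - b‖ₑ ^ 2 := by
  have h := parallelogram_law_with_norm ℝ a b
  simp only [← ofReal_norm, ← ENNReal.ofReal_pow (norm_nonneg _)]
  rw [← ENNReal.ofReal_add (by positivity) (by positivity), ← ENNReal.ofReal_ofNat,
    ← ENNReal.ofReal_mul (by norm_num)]
  refine ENNReal.ofReal_le_ofReal ?_
  nlinarith [sq_nonneg ‖a‖]

/-- The squared error of a constant approximation on a centred ball. -/
theorem lintegral_sq_ball_le_of_const {d : ℕ} {s : ℝ} (hs : 0 ≤ s)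
    (B : EuclideanSpace ℝ (Fin d) →L[ℝ] G) (hB : ∀ x, s * ‖x‖ ≤ ‖B x‖) (u : G) (r : ℝ) :
    ENNReal.ofReal (s ^ 2) * ∫⁻ x : EuclideanSpace ℝ (Fin d) in {x | ‖x‖ ^ 2 ≤ r},
        ENNReal.ofReal (‖x‖ ^ 2)
      ≤ ∫⁻ x : EuclideanSpace ℝ (Fin d) in {x | ‖x‖ ^ 2 ≤ r}, ‖u + B x‖ₑ ^ 2 := by
  have hset := measurableSet_norm_sq_le d r
  have hm1 : Measurable fun x : EuclideanSpace ℝ (Fin d) => ‖u + B x‖ₑ ^ 2 :=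
    ((by fun_prop : Continuous fun x => ‖u + B x‖ₑ ^ 2)).measurable
  -- The ball is symmetric, so the errors at `x` and `-x` may be paired; the parallelogram law then
  -- removes `u`.
  have hneg : ∫⁻ x : EuclideanSpace ℝ (Fin d) in {x | ‖x‖ ^ 2 ≤ r}, ‖u + B x‖ₑ ^ 2
      = ∫⁻ x : EuclideanSpace ℝ (Fin d) in {x | ‖x‖ ^ 2 ≤ r}, ‖u - B x‖ₑ ^ 2 := by
    rw [← lintegral_indicator hset, ← lintegral_indicator hset,
      ← (Measure.measurePreserving_neg (volume : Measure (EuclideanSpace ℝ (Fin d)))).lintegral_comp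
        (hm1.indicator hset)]
    refine lintegral_congr fun x => ?_
    simp [Set.indicator, sub_eq_add_neg]
  have h2 : 2 * (ENNReal.ofReal (s ^ 2) * ∫⁻ x : EuclideanSpace ℝ (Fin d) in {x | ‖x‖ ^ 2 ≤ r},
        ENNReal.ofReal (‖x‖ ^ 2))
      ≤ 2 * ∫⁻ x : EuclideanSpace ℝ (Fin d) in {x | ‖x‖ ^ 2 ≤ r}, ‖u + B x‖ₑ ^ 2 := by
    conv_rhs => rw [two_mul]
    nth_rewrite 2 [hneg]
    rw [← lintegral_add_left hm1, ← lintegral_const_mul' _ _ (by simp),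
      ← lintegral_const_mul' _ _ (by simp)]
    refine lintegral_mono fun x => le_trans ?_ (two_mul_enorm_sq_le u (B x))
    gcongr
    rw [← ENNReal.ofReal_mul (sq_nonneg _), ← mul_pow, ENNReal.ofReal_pow (by positivity),
      ← ofReal_norm]
    gcongr
    exact hB x
  exact (ENNReal.mul_le_mul_iff_right (by simp) (by simp)).1 h2

/-- The squared error at `f`, if `f` is in the unit ball. -/
noncomputable def ballErr (S : F →L[ℝ] G) (N : AdaptiveInfo F) (Φ : Algorithm G) (ω : ℕ → ℝ)
    (f : F) : ℝ≥0∞ :=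
  Set.indicator {f | ‖f‖ ^ 2 ≤ 1} (fun f => ‖S f - output N Φ f ω‖ₑ ^ 2) f

theorem norm_add_isometry_sq {d : ℕ} {v : F} {A : EuclideanSpace ℝ (Fin d) →ₗᵢ[ℝ] F}
    (hv : ∀ x, inner ℝ v (A x) = 0) (x : EuclideanSpace ℝ (Fin d)) :
    ‖v + A x‖ ^ 2 = ‖v‖ ^ 2 + ‖x‖ ^ 2 := by
  rw [norm_add_sq_real, hv, A.norm_map]
  ring

theorem measurable_ballErr_affine (S : F →L[ℝ] G) {N : AdaptiveInfo F} (hN : N.IsMeasurable)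
    {Φ : Algorithm G} (hΦ : ∀ n, StronglyMeasurable (Φ n)) {X : Type*} [MeasurableSpace X]
    {w : X → ℕ → ℝ} (hw : Measurable w) {d : ℕ} (v : F) (A : EuclideanSpace ℝ (Fin d) →ₗᵢ[ℝ] F)
    {x : X → EuclideanSpace ℝ (Fin d)} (hx : Measurable x) :
    Measurable fun p => ballErr S N Φ (w p) (v + A (x p)) := by
  have hcont : Continuous fun z : EuclideanSpace ℝ (Fin d) => v + A z := by fun_prop
  have hset : MeasurableSet {p | ‖v + A (x p)‖ ^ 2 ≤ 1} :=
    measurableSet_le (((by fun_prop : Continuous fun z => ‖v + A z‖ ^ 2)).measurable.comp hx)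
      measurable_const
  have hS : StronglyMeasurable fun p => S (v + A (x p)) :=
    ((S.continuous.comp hcont).stronglyMeasurable).comp_measurable hx
  have h := ((measurable_enorm_sub_output hN hΦ hw
    (f := fun p => v + A (x p))
    (AdaptiveInfo.measurable_eval_affine hN v A.toLinearMap hx) hS).pow_const 2).indicator hset
  exact h

theorem measurable_numObs_affine {N : AdaptiveInfo F} (hN : N.IsMeasurable)
    {X : Type*} [MeasurableSpace X]
    {w : X → ℕ → ℝ} (hw : Measurable w) {d : ℕ} (v : F) (A : EuclideanSpace ℝ (Fin d) →ₗᵢ[ℝ] F)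
    {x : X → EuclideanSpace ℝ (Fin d)} (hx : Measurable x) :
    Measurable fun p => (N.numObs (v + A (x p)) (w p) : ℝ≥0∞) :=
  (measurable_of_countable fun n : ℕ => (n : ℝ≥0∞)).comp
    (AdaptiveInfo.measurable_numObs hN hw
      (AdaptiveInfo.measurable_eval_affine hN v A.toLinearMap hx))

/-- For a fixed noise the information is an exact adaptive strategy. If the first `k` observations
are constant on a `d`-dimensional slice, then the error, averaged over the slice of the ball, and
the number of observations, averaged with the weight `1 - ‖f‖²`, obey a trade-off. -/
theorem slice_tradeoff (S : F →L[ℝ] G) {N : AdaptiveInfo F} (hN : N.IsMeasurable)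
    {Φ : Algorithm G} (hΦ : ∀ n, StronglyMeasurable (Φ n)) (ω : ℕ → ℝ) {s : ℝ} (hs : 0 ≤ s)
    (d : ℕ) : ∀ (j k : ℕ) (v : F) (A : EuclideanSpace ℝ (Fin d) →ₗᵢ[ℝ] F),
      (∀ x, inner ℝ v (A x) = 0) → (∀ x, s * ‖x‖ ≤ ‖S (A x)‖) →
      (∀ x, N.obs (v + A x) ω k = N.obs v ω k) → N.numObs v ω = k + j →
      ENNReal.ofReal (s ^ 2) * (d + k) * ∫⁻ x, ENNReal.ofReal (1 - ‖v + A x‖ ^ 2)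
        ≤ 2 * (∫⁻ x, ballErr S N Φ ω (v + A x)) + ENNReal.ofReal (s ^ 2) *
          ∫⁻ x, ENNReal.ofReal (1 - ‖v + A x‖ ^ 2) * N.numObs (v + A x) ω := by
  -- Outer induction on the dimension, inner on the number `j` of observations left at the base
  -- point. The number of observations may be unbounded over a slice, but it is finite at one point;
  -- after a cut `j` is chosen afresh on each piece.
  induction d using Nat.strong_induction_on with
  | _ d ihd =>
  intro j
  induction j with
  | zero =>
    intro k v A hv hA hobs hn
    -- The whole slice shares the path of `v`, hence terminates with the same output. The bound for
    -- constant approximations gives the term with `d`; the `k` observations made give the other.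
    have hY : N.obs v ω k ∈ N.Y k := N.numObs_eq_iff.1 hn
    have hn' : ∀ x, N.numObs (v + A x) ω = k := fun x => N.numObs_eq_of_mem (by rwa [hobs x])
    have hout : ∀ x, output N Φ (v + A x) ω = Φ k (N.obs v ω k) := fun x => by
      rw [output, hn' x, hobs x]
    have hset := measurableSet_norm_sq_le d (1 - ‖v‖ ^ 2)
    have herr : ∫⁻ x, ballErr S N Φ ω (v + A x)
        = ∫⁻ x : EuclideanSpace ℝ (Fin d) in {x | ‖x‖ ^ 2 ≤ 1 - ‖v‖ ^ 2},
          ‖(S v - Φ k (N.obs v ω k)) + (S.comp A.toContinuousLinearMap) x‖ₑ ^ 2 := by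
      rw [← lintegral_indicator hset]
      refine lintegral_congr fun x => ?_
      simp only [ballErr, Set.indicator, Set.mem_ofPred_eq, norm_add_isometry_sq hv, hout,
        le_sub_iff_add_le']
      congr 3
      simp
      abel
    have hw : ∀ x, 1 - ‖v + A x‖ ^ 2 = 1 - ‖v‖ ^ 2 - ‖x‖ ^ 2 := fun x => by
      rw [norm_add_isometry_sq hv]
      ring
    simp only [hn', hw]
    rw [lintegral_mul_const' _ _ (by simp), mul_add, add_mul]
    refine add_le_add ?_ (le_of_eq (by ring))
    rw [mul_assoc, ← lintegral_norm_sq_ball, herr, mul_left_comm]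
    gcongr
    exact lintegral_sq_ball_le_of_const hs (S.comp A.toContinuousLinearMap) hA _ _
  | succ j ihj =>
    intro k v A hv hA hobs hn
    have hY : ∀ i ≤ k, ∀ f, N.obs f ω k = N.obs v ω k → N.obs f ω i ∉ N.Y i := by
      intro i hi f hf hmem
      have h1 : N.obs f ω i = N.obs v ω i := by
        rw [← N.obs_castLE f ω hi, ← N.obs_castLE v ω hi, hf]
      rw [h1] at hmem
      have := N.numObs_eq_of_mem hmem
      omega
    have hsnoc : ∀ f g : F, N.obs f ω k = N.obs g ω k →
        N.L k (N.obs v ω k) f = N.L k (N.obs v ω k) g → N.obs f ω k = N.obs v ω k →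
        N.obs f ω (k + 1) = N.obs g ω (k + 1) := by
      intro f g h1 h2 h3
      have h4 : N.obs g ω k = N.obs v ω k := h1 ▸ h3
      simp only [AdaptiveInfo.obs, h3, h4, h2]
    by_cases hl : ∀ x, N.L k (N.obs v ω k) (A x) = 0
    -- An observation that is constant on the slice wastes a step: `d` stays and `k` grows, so a
    -- stronger inequality results.
    · have h := ihj (k + 1) v A hv hA (fun x => hsnoc _ _ (hobs x) (by simp [hl x]) (hobs x))
        (by omega)
      refine le_trans ?_ h
      gcongr
      simp
    · obtain _ | d := d
      · exact absurd (fun x => by rw [Subsingleton.elim x 0, map_zero, map_zero]) hl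
      obtain ⟨v', A', c, hex, hex', hv', hl', hint⟩ :=
        exists_slicing v A hv (N.L k (N.obs v ω k))
      have hobs' : ∀ t z, N.obs (v' t + A' z) ω k = N.obs v ω k := fun t z => by
        obtain ⟨x, hx⟩ := hex t z
        rw [hx, hobs]
      have hA' : ∀ z, s * ‖z‖ ≤ ‖S (A' z)‖ := fun z => by
        obtain ⟨x, hx, hxz⟩ := hex' z
        rw [hx, ← hxz]
        exact hA x
      have hobs0 : ∀ t, N.obs (v' t) ω k = N.obs v ω k := fun t => by
        simpa using hobs' t 0
      have hl0 : ∀ t, N.L k (N.obs v ω k) (v' t) = N.L k (N.obs v ω k) v + c * t := fun t => by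
        simpa using hl' t 0
      -- A level set loses one dimension and gains one observation, so the sum of dimension and
      -- observation count is the same on every piece and the inequalities can be integrated over
      -- `t`.
      have key : ∀ t, ENNReal.ofReal (s ^ 2) * ((d + 1 : ℕ) + k) *
          (∫⁻ z, ENNReal.ofReal (1 - ‖v' t + A' z‖ ^ 2))
          ≤ 2 * (∫⁻ z, ballErr S N Φ ω (v' t + A' z)) + ENNReal.ofReal (s ^ 2) *
            ∫⁻ z, ENNReal.ofReal (1 - ‖v' t + A' z‖ ^ 2) * N.numObs (v' t + A' z) ω := by
        intro t
        have hlt : k + 1 ≤ N.numObs (v' t) ω := by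
          by_contra! hlt
          exact hY _ (Nat.lt_succ_iff.1 hlt) _ (hobs0 t) (N.obs_numObs_mem _ _)
        have h := ihd d (Nat.lt_succ_self d) (N.numObs (v' t) ω - (k + 1)) (k + 1) (v' t) A'
          (hv' t) hA' (fun z => hsnoc _ _ ((hobs' t z).trans (hobs0 t).symm)
            ((hl' t z).trans (hl0 t).symm) (hobs' t z)) (by omega)
        refine le_trans (le_of_eq ?_) h
        congr 2
        push_cast
        ring
      have hmw : Measurable fun x => ENNReal.ofReal (1 - ‖v + A x‖ ^ 2) :=
        ((by fun_prop : Continuous fun x => 1 - ‖v + A x‖ ^ 2)).measurable.ennreal_ofReal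
      have hme : Measurable fun x => ballErr S N Φ ω (v + A x) :=
        measurable_ballErr_affine S hN hΦ (w := fun _ => ω) measurable_const v A measurable_id
      have hmn : Measurable fun x => ENNReal.ofReal (1 - ‖v + A x‖ ^ 2) * N.numObs (v + A x) ω :=
        hmw.mul (measurable_numObs_affine hN (w := fun _ => ω) measurable_const v A measurable_id)
      obtain ⟨-, h1⟩ := hint (fun f => ENNReal.ofReal (1 - ‖f‖ ^ 2)) hmw
      obtain ⟨h2m, h2⟩ := hint (fun f => ballErr S N Φ ω f) hme
      obtain ⟨-, h3⟩ := hint (fun f => ENNReal.ofReal (1 - ‖f‖ ^ 2) * N.numObs f ω) hmn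
      rw [h1, h2, h3, ← lintegral_const_mul' _ _ (by finiteness),
        ← lintegral_const_mul' _ _ (by finiteness), ← lintegral_const_mul' _ _ (by finiteness),
        ← lintegral_add_left (h2m.const_mul _)]
      exact lintegral_mono key

/-- The cost of noisy information needed on a subspace where `S` is bounded from below. -/
theorem le_costWA_of_isometry (S : F →L[ℝ] G) {N : AdaptiveInfo F} (hN : N.IsMeasurable)
    {Φ : Algorithm G} (hΦ : ∀ n, StronglyMeasurable (Φ n)) {cost : ℝ≥0 → ℝ≥0∞}
    (hc : ∀ σ, 1 ≤ cost σ) {ε : ℝ≥0} (hε : 0 < ε) (hS : S ≠ 0)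
    (herr : errWA S (Metric.closedBall 0 1) N Φ ≤ ε * ‖S‖ₑ) {m : ℕ}
    (A : EuclideanSpace ℝ (Fin m) →ₗᵢ[ℝ] F) (hA : ∀ x, 2 * ε * ‖S‖ * ‖x‖ ≤ ‖S (A x)‖) :
    (4 * m : ℝ≥0∞) ≤ (m + 2) + 4 * costWA cost (Metric.closedBall 0 1) N := by
  set C := costWA cost (Metric.closedBall 0 1) N with hC
  set s : ℝ := 2 * ε * ‖S‖ with hs
  have hs0 : 0 < s := by
    have : 0 < ‖S‖ := norm_pos_iff.2 hS
    positivity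
  have hball : ∀ f : F, ‖f‖ ^ 2 ≤ 1 → f ∈ Metric.closedBall (0 : F) 1 := fun f hf => by
    simpa using hf
  set H : ℝ≥0∞ := ∫⁻ x : EuclideanSpace ℝ (Fin m), ENNReal.ofReal (1 - ‖x‖ ^ 2) with hH
  have hnorm : ∀ x, ‖(0 : F) + A x‖ ^ 2 = ‖x‖ ^ 2 := fun x => by simp
  have h1 : ∀ ω, ENNReal.ofReal (s ^ 2) * m * H ≤ 2 * (∫⁻ x, ballErr S N Φ ω (0 + A x)) +
      ENNReal.ofReal (s ^ 2) * ∫⁻ x, ENNReal.ofReal (1 - ‖x‖ ^ 2) * N.numObs (0 + A x) ω := by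
    intro ω
    have h := slice_tradeoff S hN hΦ ω hs0.le m (N.numObs 0 ω) 0 0 A (by simp) hA
      (fun x => funext fun i => i.elim0) (by simp)
    simpa only [hnorm, Nat.cast_zero, add_zero] using h
  have hme : Measurable fun p : EuclideanSpace ℝ (Fin m) × (ℕ → ℝ) =>
      ballErr S N Φ p.2 (0 + A p.1) :=
    measurable_ballErr_affine S hN hΦ measurable_snd 0 A measurable_fst
  have hmn : Measurable fun p : EuclideanSpace ℝ (Fin m) × (ℕ → ℝ) =>
      ENNReal.ofReal (1 - ‖p.1‖ ^ 2) * N.numObs (0 + A p.1) p.2 :=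
    Measurable.mul (by fun_prop) (measurable_numObs_affine hN measurable_snd 0 A measurable_fst)
  have h2 : ENNReal.ofReal (s ^ 2) * m * H ≤
      2 * (∫⁻ x, ∫⁻ ω, ballErr S N Φ ω (0 + A x) ∂stdNoise) + ENNReal.ofReal (s ^ 2) *
        ∫⁻ x, ∫⁻ ω, ENNReal.ofReal (1 - ‖x‖ ^ 2) * N.numObs (0 + A x) ω ∂stdNoise := by
    calc ENNReal.ofReal (s ^ 2) * m * H = ∫⁻ _, ENNReal.ofReal (s ^ 2) * m * H ∂stdNoise := by simp
      _ ≤ _ := lintegral_mono h1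
      _ = _ := by
        rw [lintegral_add_left, lintegral_const_mul' _ _ (by finiteness),
          lintegral_const_mul' _ _ (by finiteness),
          ← lintegral_lintegral_swap (f := fun x ω => ballErr S N Φ ω (0 + A x)) hme.aemeasurable,
          ← lintegral_lintegral_swap (f := fun x ω => ENNReal.ofReal (1 - ‖x‖ ^ 2) *
            N.numObs (0 + A x) ω) hmn.aemeasurable]
        exact (hme.lintegral_prod_left').const_mul _
  have hE : ∫⁻ x, ∫⁻ ω, ballErr S N Φ ω (0 + A x) ∂stdNoise
      ≤ (ε * ‖S‖ₑ) ^ 2 * volume {x : EuclideanSpace ℝ (Fin m) | ‖x‖ ^ 2 ≤ 1} := by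
    rw [← setLIntegral_const, ← lintegral_indicator (measurableSet_norm_sq_le m 1)]
    refine lintegral_mono fun x => ?_
    by_cases hx : ‖x‖ ^ 2 ≤ 1
    · rw [Set.indicator_of_mem (by exact hx)]
      have hx' : ‖(0 : F) + A x‖ ^ 2 ≤ 1 := by rwa [hnorm]
      simp only [ballErr]
      rw [lintegral_congr fun ω => Set.indicator_of_mem (by exact hx') _]
      exact lintegral_sq_le_of_errWA_le herr (hball _ hx')
    · have hx' : ¬ ‖(0 : F) + A x‖ ^ 2 ≤ 1 := by rwa [hnorm]
      simp only [ballErr]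
      rw [lintegral_congr fun ω => Set.indicator_of_notMem (by exact hx') _]
      simp
  have hNn : ∫⁻ x, ∫⁻ ω, ENNReal.ofReal (1 - ‖x‖ ^ 2) * N.numObs (0 + A x) ω ∂stdNoise
      ≤ H * C := by
    rw [hH, ← lintegral_mul_const _ (by fun_prop)]
    refine lintegral_mono fun x => ?_
    rw [lintegral_const_mul' _ _ (by simp)]
    by_cases hx : ‖x‖ ^ 2 ≤ 1
    · gcongr
      exact lintegral_numObs_le_costWA hc N (hball _ (by rwa [hnorm]))
    · rw [ENNReal.ofReal_eq_zero.2 (by linarith)]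
      simp
  have hs4 : ENNReal.ofReal (s ^ 2) = 4 * (ε * ‖S‖ₑ) ^ 2 := by
    rw [hs, ← ofReal_norm, ENNReal.ofReal_pow (by positivity), mul_assoc,
      ENNReal.ofReal_mul (by norm_num), ENNReal.ofReal_mul (by positivity), mul_pow]
    simp
    norm_num
  have hpos : ENNReal.ofReal (s ^ 2) ≠ 0 := by simpa using hs0.ne'
  set a : ℝ≥0∞ := (ε * ‖S‖ₑ) ^ 2 with ha
  have ha0 : a ≠ 0 := fun h => hpos (by rw [hs4, h, mul_zero])
  have haT : a ≠ ∞ := by rw [ha]; finiteness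
  have hH0 : H ≠ 0 := lintegral_ball_weight_ne_zero m
  have hHT : H ≠ ∞ := lintegral_ball_weight_ne_top m
  -- Here `s² = 4a` and twice the volume of the ball is `(m + 2) H`. The factor `2` in `2ε` makes
  -- `4m` on the left outweigh the `m` from the volume.
  have h3 : (a * H) * (4 * m) ≤ (a * H) * ((m + 2) + 4 * C) := by
    calc (a * H) * (4 * m) = ENNReal.ofReal (s ^ 2) * m * H := by rw [hs4]; ring
      _ ≤ _ := h2
      _ ≤ 2 * (a * volume {x : EuclideanSpace ℝ (Fin m) | ‖x‖ ^ 2 ≤ 1})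
          + ENNReal.ofReal (s ^ 2) * (H * C) := by gcongr
      _ = a * (2 * volume {x : EuclideanSpace ℝ (Fin m) | ‖x‖ ^ 2 ≤ 1}) + 4 * a * (H * C) := by
          rw [hs4]; ring
      _ = _ := by rw [volume_ball_eq]; ring
  exact (ENNReal.mul_le_mul_iff_right (mul_ne_zero ha0 hH0) (ENNReal.mul_ne_top haT hHT)).1 h3

end FixedNoise

end NoisyInfo

namespace NoisyInfo

/-! ### Singular vectors of a compact operator -/

section Spectral

variable {F G : Type*} [NormedAddCommGroup F] [InnerProductSpace ℝ F] [CompleteSpace F]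
  [NormedAddCommGroup G] [InnerProductSpace ℝ G] [CompleteSpace G]

/-- A compact operator attains its norm, at a singular vector. -/
theorem exists_singularVector (S : F →L[ℝ] G) (hS : IsCompactOperator S) {s : ℝ} (hs : 0 ≤ s)
    {x : F} (hx : s * ‖x‖ < ‖S x‖) :
    ∃ (u : F) (μ : ℝ), ‖u‖ = 1 ∧ s ^ 2 < μ ∧ ∀ y, inner ℝ (S u) (S y) = μ * inner ℝ u y := by
  set T : F →L[ℝ] F := (ContinuousLinearMap.adjoint S).comp S with hT
  have hx0 : x ≠ 0 := by
    rintro rfl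
    simp at hx
  have : Nontrivial F := ⟨x, 0, hx0⟩
  have hTS : ∀ y z, inner ℝ (T y) z = inner ℝ (S y) (S z) := fun y z => by
    rw [hT, ContinuousLinearMap.comp_apply, ContinuousLinearMap.adjoint_inner_left]
  have hcomp : IsCompactOperator T := hS.clm_comp (ContinuousLinearMap.adjoint S)
  have hsymm : T.IsSymmetric := fun y z => by
    change inner ℝ (T y) z = inner ℝ y (T z)
    rw [hTS, real_inner_comm, ← hTS, real_inner_comm]
  have hR : ∀ y, T.rayleighQuotient y = ‖S y‖ ^ 2 / ‖y‖ ^ 2 := fun y => by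
    simp [ContinuousLinearMap.rayleighQuotient, ContinuousLinearMap.reApplyInnerSelf_apply, hTS]
  have hxpos : 0 < ‖x‖ := norm_pos_iff.2 hx0
  have hnorm : s ^ 2 < ‖T‖ := by
    refine lt_of_lt_of_le ?_ ((le_abs_self _).trans (T.rayleighQuotient_le_norm x))
    rw [hR, lt_div_iff₀ (by positivity), ← mul_pow]
    exact pow_lt_pow_left₀ hx (by positivity) (by norm_num)
  -- `T = S*S` is positive, so its norm is the supremum of its Rayleigh quotient; were `‖T‖` in the
  -- resolvent set, the quotient would stay below `‖T‖` by a fixed gap. Compactness then makes this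
  -- nonzero spectral value an eigenvalue.
  have hspec : ‖T‖ ∈ spectrum ℝ T := by
    by_contra hns
    obtain ⟨δ, hδ, hle⟩ := T.rayleighQuotient_le_of_norm_mem_resolventSet
      (spectrum.notMem_iff.1 hns)
    have h1 : ‖T‖ ≤ ‖T‖ - δ := by
      conv_lhs => rw [T.norm_eq_iSup_rayleighQuotient hsymm]
      refine ciSup_le fun y => ?_
      rw [abs_of_nonneg (by rw [hR]; positivity)]
      exact hle y
    linarith
  obtain ⟨v, hv⟩ := ((hcomp.hasEigenvalue_iff_mem_spectrum
    ((sq_nonneg s).trans_lt hnorm).ne').2 hspec).exists_hasEigenvector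
  have hTv : T v = ‖T‖ • v := hv.apply_eq_smul
  have hv0 : ‖v‖ ≠ 0 := norm_ne_zero_iff.2 hv.2
  refine ⟨‖v‖⁻¹ • v, ‖T‖, by simp [norm_smul, hv0], hnorm, fun y => ?_⟩
  rw [← hTS, map_smul, hTv, smul_comm, real_inner_smul_left]

/-- Either `S` has `k` singular values above `s`, or `S` is bounded by `s` on the orthogonal
complement of fewer than `k` vectors. -/
theorem exists_orthonormal_singularVectors (S : F →L[ℝ] G) (hS : IsCompactOperator S) {s : ℝ}
    (hs : 0 ≤ s) (k : ℕ) :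
    (∃ j < k, ∃ e : Fin j → F, Orthonormal ℝ e ∧
      ∀ x, (∀ i, inner ℝ (e i) x = 0) → ‖S x‖ ≤ s * ‖x‖) ∨
    ∃ (e : Fin k → F) (μ : Fin k → ℝ), Orthonormal ℝ e ∧ (∀ i, s ^ 2 < μ i) ∧
      ∀ i y, inner ℝ (S (e i)) (S y) = μ i * inner ℝ (e i) y := by
  induction k with
  | zero =>
    exact Or.inr ⟨Fin.elim0, Fin.elim0, ⟨fun i => i.elim0, fun i => i.elim0⟩, fun i => i.elim0,
      fun i => i.elim0⟩
  | succ k ih =>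
    rcases ih with ⟨j, hj, h⟩ | ⟨e, μ, he, hμ, hSe⟩
    · exact Or.inl ⟨j, hj.trans (Nat.lt_succ_self k), h⟩
    by_cases hle : ∀ x, (∀ i, inner ℝ (e i) x = 0) → ‖S x‖ ≤ s * ‖x‖
    · exact Or.inl ⟨k, Nat.lt_succ_self k, e, he, hle⟩
    push Not at hle
    obtain ⟨x, hx, hSx⟩ := hle
    right
    set V := Submodule.span ℝ (Set.range e) with hV
    have hmem : ∀ y, y ∈ Vᗮ ↔ ∀ i, inner ℝ (e i) y = 0 := fun y => by
      rw [hV, Submodule.mem_orthogonal]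
      constructor
      · exact fun h i => h _ (Submodule.subset_span ⟨i, rfl⟩)
      · intro h u hu
        induction hu using Submodule.span_induction with
        | mem u hu =>
          obtain ⟨i, rfl⟩ := hu
          exact h i
        | zero => simp
        | add a b _ _ ha hb => rw [inner_add_left, ha, hb, add_zero]
        | smul c a _ ha => rw [real_inner_smul_left, ha, mul_zero]
    -- The next vector comes from the restriction of `S` to the complement of those found so far.
    obtain ⟨u, ν, hu1, hν, hu⟩ := exists_singularVector (S.comp Vᗮ.subtypeL)
      (hS.comp_clm Vᗮ.subtypeL) hs (x := ⟨x, (hmem x).2 hx⟩) hSx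
    have hue : ∀ i, inner ℝ (e i) (u : F) = 0 := (hmem u).1 u.2
    refine ⟨Fin.snoc (α := fun _ => F) e (u : F), Fin.snoc (α := fun _ => ℝ) μ ν, ?_, ?_, ?_⟩
    · rw [orthonormal_iff_ite]
      have he' := orthonormal_iff_ite.1 he
      intro a b
      refine Fin.lastCases ?_ (fun a => ?_) a <;> refine Fin.lastCases ?_ (fun b => ?_) b
      · have hu1' : ‖(u : F)‖ = 1 := hu1
        simp [hu1']
      · simp [real_inner_comm _ (u : F), hue, (Fin.castSucc_lt_last b).ne']
      · simp [hue, (Fin.castSucc_lt_last a).ne]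
      · simp [he']
    · intro a
      refine Fin.lastCases ?_ (fun a => ?_) a
      · simpa using hν
      · simpa using hμ a
    · intro a y
      refine Fin.lastCases ?_ (fun a => ?_) a
      · simp only [Fin.snoc_last]
        have : V.HasOrthogonalProjection := by
          have : FiniteDimensional ℝ V := FiniteDimensional.span_of_finite ℝ (Set.finite_range e)
          infer_instance
        obtain ⟨y₁, hy₁, y₂, hy₂, rfl⟩ := V.exists_add_mem_mem_orthogonal y
        have h2 : inner ℝ (S u) (S y₂) = ν * inner ℝ (u : F) y₂ := hu ⟨y₂, hy₂⟩
        -- The relation for `u` is so far known only against `Vᗮ`. Against `V` both sides vanish,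
        -- because the `e i` are singular vectors orthogonal to `u`.
        have h1 : inner ℝ (S u) (S y₁) = 0 ∧ inner ℝ (u : F) y₁ = 0 := by
          induction hy₁ using Submodule.span_induction with
          | mem z hz =>
            obtain ⟨i, rfl⟩ := hz
            rw [real_inner_comm, hSe, hue, real_inner_comm, hue]
            simp
          | zero => simp
          | add a b _ _ ha hb => simp [inner_add_right, ha, hb]
          | smul c a _ ha => simp [real_inner_smul_right, ha]
        rw [map_add, inner_add_right, inner_add_right, h1.1, h1.2, h2]
        ring
      · simpa using hSe a y

end Spectral

/-! ### Exact information from singular vectors -/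

section Exact

theorem enorm_le_coe_mul_enorm_iff {E E' : Type*} [SeminormedAddGroup E] [SeminormedAddGroup E']
    {a : E} {b : E'} {ε : ℝ≥0} : ‖a‖ₑ ≤ ε * ‖b‖ₑ ↔ ‖a‖ ≤ ε * ‖b‖ := by
  rw [enorm_eq_nnnorm, enorm_eq_nnnorm]
  exact_mod_cast Iff.rfl

variable {F G : Type*} [NormedAddCommGroup F] [InnerProductSpace ℝ F]
  [NormedAddCommGroup G] [InnerProductSpace ℝ G]

/-- The images `S (e i)` are orthogonal with squared norms `μ i`, so `‖S (A x)‖² = ∑ μ i * x i ^ 2`.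
-/
theorem exists_isometry_of_singularVectors (S : F →L[ℝ] G) {s : ℝ} (hs : 0 ≤ s) {k : ℕ}
    {e : Fin k → F} {μ : Fin k → ℝ} (he : Orthonormal ℝ e) (hμ : ∀ i, s ^ 2 < μ i)
    (hSe : ∀ i y, inner ℝ (S (e i)) (S y) = μ i * inner ℝ (e i) y) :
    ∃ A : EuclideanSpace ℝ (Fin k) →ₗᵢ[ℝ] F, ∀ x, s * ‖x‖ ≤ ‖S (A x)‖ := by
  set B : EuclideanSpace ℝ (Fin k) →ₗ[ℝ] F :=
    (EuclideanSpace.basisFun (Fin k) ℝ).toBasis.constr ℝ e with hB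
  have hBx : ∀ x, B x = ∑ i, x i • e i := fun x => by
    simp [hB, Module.Basis.constr_apply_fintype]
  have hBe : ∀ x i, inner ℝ (e i) (B x) = x i := fun x i => by
    rw [hBx, he.inner_right_fintype]
  have hiso : ∀ x, ‖B x‖ = ‖x‖ := fun x => by
    rw [← sq_eq_sq₀ (norm_nonneg _) (norm_nonneg _), ← real_inner_self_eq_norm_sq,
      EuclideanSpace.real_norm_sq_eq]
    conv_lhs => rw [hBx x, sum_inner]
    refine Finset.sum_congr rfl fun i _ => ?_
    rw [real_inner_smul_left, ← hBx, hBe]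
    ring
  refine ⟨⟨B, hiso⟩, fun x => ?_⟩
  change s * ‖x‖ ≤ ‖S (B x)‖
  rw [← sq_le_sq₀ (by positivity) (norm_nonneg _), mul_pow, ← real_inner_self_eq_norm_sq (S (B x)),
    EuclideanSpace.real_norm_sq_eq]
  have h : inner ℝ (S (B x)) (S (B x)) = ∑ i, μ i * x i ^ 2 := by
    have h0 : S (B x) = ∑ i, x i • S (e i) := by simp [hBx x, map_sum]
    nth_rewrite 1 [h0]
    rw [sum_inner]
    refine Finset.sum_congr rfl fun i _ => ?_
    rw [real_inner_smul_left, hSe, hBe]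
    ring
  rw [h, Finset.mul_sum]
  exact Finset.sum_le_sum fun i _ => mul_le_mul_of_nonneg_right (hμ i).le (sq_nonneg _)

/-- Nonadaptive exact information consisting of the coefficients with respect to `e`. -/
noncomputable def coeffInfo {k : ℕ} (e : Fin k → F) (he : Orthonormal ℝ e) : AdaptiveInfo F where
  L i _ := if h : i < k then innerSL ℝ (e ⟨i, h⟩) else 0
  norm_L_le i y := by
    split_ifs with h
    · rw [innerSL_apply_norm, he.1]
    · simp
  σ _ _ := 0
  Y n := {_y | n = k}
  existsUnique_mem y := ⟨k, rfl, fun _ h => h⟩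

/-- The coefficients determine the orthogonal projection `p` of `f` onto the span of `e`. The output
`S p` has error `S (f - p)`, where `f - p` is orthogonal to `e` and of norm at most one. -/
theorem nWorst_le_of_orthonormal (S : F →L[ℝ] G) (ε : ℝ≥0) {k : ℕ} {e : Fin k → F}
    (he : Orthonormal ℝ e)
    (hS : ∀ x, (∀ i, inner ℝ (e i) x = 0) → ‖S x‖ ≤ ε * ‖S‖ * ‖x‖) :
    nWorst S ε ≤ k := by
  set N := coeffInfo e he with hN
  have hnum : ∀ f ω, N.numObs f ω = k := fun f ω =>
    N.numObs_eq_of_mem (show k = k from rfl)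
  have hobs : ∀ f (i : Fin k), N.obs f 0 k i = inner ℝ (e i) f := fun f i => by
    rw [N.obs_eq]
    simp only [AdaptiveInfo.obs, Fin.snoc_last]
    simp [hN, coeffInfo]
  refine sInf_le_of_le ⟨N, fun n y => ∑ i : Fin n, if h : (i : ℕ) < k then y i • S (e ⟨i, h⟩) else 0,
    fun i y => rfl, ?_, rfl⟩ ?_
  · refine iSup₂_le fun f hf => ?_
    have hout : output N (fun n y => ∑ i : Fin n,
        if h : (i : ℕ) < k then y i • S (e ⟨i, h⟩) else 0) f 0
        = S (∑ i, (inner ℝ (e i) f : ℝ) • e i) := by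
      rw [output, hnum f 0, map_sum]
      refine Finset.sum_congr rfl fun i _ => ?_
      rw [hobs]
      simp
    set p := ∑ i, (inner ℝ (e i) f : ℝ) • e i with hp
    have hperp : ∀ i, inner ℝ (e i) (f - p) = 0 := fun i => by
      rw [inner_sub_right, hp, he.inner_right_fintype, sub_self]
    have hpp : inner ℝ p (f - p) = 0 := by
      conv_lhs => rw [hp, sum_inner]
      refine Finset.sum_eq_zero fun i _ => ?_
      rw [← hp, real_inner_smul_left, hperp, mul_zero]
    have hle : ‖f - p‖ ≤ 1 := by
      have h1 : ‖f‖ ^ 2 = ‖p‖ ^ 2 + ‖f - p‖ ^ 2 := by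
        have h2 := norm_add_sq_real p (f - p)
        rw [hpp] at h2
        simpa using h2
      have h3 : ‖f‖ ≤ 1 := by simpa using hf
      nlinarith [norm_nonneg f, norm_nonneg (f - p), sq_nonneg ‖p‖]
    rw [hout, ← map_sub]
    have h4 : ‖S (f - p)‖ ≤ ε * ‖S‖ := (hS _ hperp).trans
      (mul_le_of_le_one_right (by positivity) hle)
    exact enorm_le_coe_mul_enorm_iff.2 h4
  · refine iSup₂_le fun f _ => ?_
    rw [hnum]

end Exact

/-! ### The bound by the complexity for exact information -/

section FirstBound

variable {F G : Type*} [NormedAddCommGroup F] [InnerProductSpace ℝ F]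
  [NormedAddCommGroup G] [InnerProductSpace ℝ G]

/-- Whether the empty sequence terminates depends on neither `f` nor the noise. If it does, the
output is constant, and comparing `f` with `-f` yields `‖S‖ ≤ ε ‖S‖`. Otherwise every path pays for
at least one observation. -/
theorem one_le_costWA {S : F →L[ℝ] G} {N : AdaptiveInfo F} {Φ : Algorithm G}
    {cost : ℝ≥0 → ℝ≥0∞} (hc : ∀ σ, 1 ≤ cost σ) {ε : ℝ≥0} (hε : ε < 1) (hS : S ≠ 0)
    (herr : errWA S (Metric.closedBall 0 1) N Φ ≤ ε * ‖S‖ₑ) :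
    1 ≤ costWA cost (Metric.closedBall 0 1) N := by
  have hS0 : 0 < ‖S‖ := norm_pos_iff.2 hS
  by_cases h0 : (Fin.elim0 : Fin 0 → ℝ) ∈ N.Y 0
  · exfalso
    have hnum : ∀ f ω, N.numObs f ω = 0 := fun f ω => N.numObs_eq_of_mem h0
    have hle : ∀ f : F, ‖f‖ ≤ 1 → ‖S f - Φ 0 Fin.elim0‖ ≤ ε * ‖S‖ := by
      intro f hf
      have h := lintegral_sq_le_of_errWA_le herr (f := f) (by simpa using hf)
      have hout : ∀ ω, output N Φ f ω = Φ 0 Fin.elim0 := fun ω => by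
        rw [output, hnum f ω, AdaptiveInfo.obs]
      simp only [hout, lintegral_const, measure_univ, mul_one] at h
      have h2 : ‖S f - Φ 0 Fin.elim0‖ₑ ≤ ε * ‖S‖ₑ := (ENNReal.pow_le_pow_left_iff two_ne_zero).1 h
      exact enorm_le_coe_mul_enorm_iff.1 h2
    have hnorm : ‖S‖ ≤ ε * ‖S‖ := by
      refine S.opNorm_le_of_unit_norm (by positivity) fun f hf => ?_
      have h1 := hle f hf.le
      have h2 := hle (-f) (by rw [norm_neg, hf])
      have h3 : (2 : ℝ) * ‖S f‖ ≤ ‖S f - Φ 0 Fin.elim0‖ + ‖S (-f) - Φ 0 Fin.elim0‖ := by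
        rw [← Real.norm_two, ← norm_smul]
        refine le_trans (le_of_eq ?_) (norm_sub_le _ _)
        congr 1
        rw [map_neg, two_smul]
        abel
      linarith
    have : (ε : ℝ) < 1 := hε
    nlinarith
  · refine le_trans ?_ (lintegral_numObs_le_costWA hc N (f := 0) (by simp))
    have hpos : ∀ ω, (1 : ℝ≥0∞) ≤ N.numObs 0 ω := fun ω => by
      have : N.numObs 0 ω ≠ 0 := fun h => h0 (N.numObs_eq_iff.1 h)
      exact_mod_cast Nat.one_le_iff_ne_zero.2 this
    calc (1 : ℝ≥0∞) = ∫⁻ _, 1 ∂stdNoise := by simp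
      _ ≤ _ := lintegral_mono hpos

/-- For the least integer `k ≥ nWorst S (2 * ε)` there must be `k` singular values above `2ε‖S‖`, so
`3k - 2 ≤ 4C`. This gives `k + 1 ≤ 4C` if `k ≥ 2`; for `k ≤ 1` the bound `1 ≤ C` suffices. -/
theorem nWorst_add_one_div_four_le_compWA [CompleteSpace F] [CompleteSpace G] {S : F →L[ℝ] G}
    (hS : S ≠ 0) (hcomp : IsCompactOperator S) {cost : ℝ≥0 → ℝ≥0∞} (hc : ∀ σ, 1 ≤ cost σ)
    {ε : ℝ≥0} (hε0 : 0 < ε) (hε1 : ε < 1) :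
    (nWorst S (2 * ε) + 1) / 4 ≤ compWA cost S ε := by
  refine le_sInf ?_
  rintro _ ⟨N, Φ, hN, hΦ, herr, rfl⟩
  set C := costWA cost (Metric.closedBall (0 : F) 1) N with hC
  have h1C : 1 ≤ C := one_le_costWA hc hε1 hS herr
  rw [ENNReal.div_le_iff (by simp) (by simp)]
  rcases eq_or_ne C ∞ with hCT | hCT
  · rw [hCT]
    simp
  have hs : (0 : ℝ) ≤ 2 * ε * ‖S‖ := by positivity
  have hdich : ∀ k : ℕ, (∃ j < k, nWorst S (2 * ε) ≤ j) ∨ (4 * k : ℝ) ≤ k + 2 + 4 * C.toReal := by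
    intro k
    rcases exists_orthonormal_singularVectors S hcomp hs k with
      ⟨j, hj, e, he, hle⟩ | ⟨e, μ, he, hμ, hSe⟩
    · exact Or.inl ⟨j, hj, nWorst_le_of_orthonormal S (2 * ε) he (by simpa using hle)⟩
    · obtain ⟨A, hA⟩ := exists_isometry_of_singularVectors S hs he hμ hSe
      right
      have h := le_costWA_of_isometry S hN hΦ hc hε0 hS herr A hA
      rw [← hC, ← ENNReal.ofReal_toReal hCT] at h
      have h' : ENNReal.ofReal (4 * k) ≤ ENNReal.ofReal (k + 2 + 4 * C.toReal) := by
        rw [ENNReal.ofReal_add (by positivity) (by positivity), ENNReal.ofReal_mul (by norm_num),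
          ENNReal.ofReal_mul (by norm_num), ENNReal.ofReal_add (by positivity) (by positivity)]
        simpa using h
      exact (ENNReal.ofReal_le_ofReal_iff (by positivity)).1 h'
  have h1R : 1 ≤ C.toReal := by
    rw [← ENNReal.toReal_one]
    exact ENNReal.toReal_mono hCT h1C
  have hfin : ∃ k : ℕ, nWorst S (2 * ε) ≤ k := by
    obtain ⟨k, hk⟩ := exists_nat_gt (2 + 4 * C.toReal)
    rcases hdich k with ⟨j, -, hj⟩ | h
    · exact ⟨j, hj⟩
    · exfalso
      have : (0 : ℝ) ≤ k := Nat.cast_nonneg k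
      linarith
  classical
  have hk := Nat.find_spec hfin
  have hmin : ∀ j : ℕ, nWorst S (2 * ε) ≤ j → Nat.find hfin ≤ j := fun j hj => Nat.find_min' hfin (m := j) hj
  set k := Nat.find hfin
  have hreal : (k + 1 : ℝ) ≤ C.toReal * 4 := by
    rcases hdich k with ⟨j, hj, hj'⟩ | h
    · exact absurd (hmin j hj') (not_le.2 hj)
    · rcases Nat.lt_or_ge k 2 with hk2 | hk2
      · have : (k : ℝ) ≤ 1 := by exact_mod_cast Nat.lt_succ_iff.1 hk2
        linarith
      · have : (2 : ℝ) ≤ k := by exact_mod_cast hk2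
        linarith
  calc nWorst S (2 * ε) + 1 ≤ k + 1 := by gcongr
    _ = ENNReal.ofReal (k + 1) := by
        rw [ENNReal.ofReal_add (by positivity) (by positivity)]
        simp
    _ ≤ ENNReal.ofReal (C.toReal * 4) := ENNReal.ofReal_le_ofReal hreal
    _ = C * 4 := by
        rw [ENNReal.ofReal_mul (by positivity), ENNReal.ofReal_toReal hCT]
        simp

end FirstBound

end NoisyInfo

namespace NoisyInfo

/-! ### Gaussian noise: independence and translation -/

section Noise

/-- The first `n` noise variables, continued by zero. -/
noncomputable def truncNoise (n : ℕ) (ω : ℕ → ℝ) : ℕ → ℝ := fun i => if i < n then ω i else 0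

theorem measurable_truncNoise (n : ℕ) : Measurable (truncNoise n) := by
  refine measurable_pi_iff.2 fun i => ?_
  unfold truncNoise
  split_ifs
  · exact measurable_pi_apply i
  · exact measurable_const

theorem map_eval_stdNoise (n : ℕ) : stdNoise.map (fun ω => ω n) = gaussianReal 0 1 :=
  Measure.infinitePi_map_eval (fun _ : ℕ => gaussianReal 0 1) n

theorem iIndepFun_stdNoise : iIndepFun (fun (i : ℕ) (ω : ℕ → ℝ) => ω i) stdNoise :=
  iIndepFun_infinitePi (P := fun _ : ℕ => gaussianReal 0 1) (X := fun _ x => x)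
    fun _ => measurable_id

theorem indepFun_truncNoise (n : ℕ) :
    IndepFun (truncNoise n) (fun ω : ℕ → ℝ => ω n) stdNoise := by
  have h := iIndepFun_stdNoise.indepFun_finset (Finset.range n) {n}
    (by simp) fun i => measurable_pi_apply i
  have hφ : Measurable fun (z : Finset.range n → ℝ) (i : ℕ) =>
      if hi : i ∈ Finset.range n then z ⟨i, hi⟩ else 0 := by
    refine measurable_pi_iff.2 fun i => ?_
    split_ifs
    · exact measurable_pi_apply _
    · exact measurable_const
  have hψ : Measurable fun z : ({n} : Finset ℕ) → ℝ => z ⟨n, Finset.mem_singleton_self n⟩ :=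
    measurable_pi_apply _
  have h2 := h.comp hφ hψ
  convert h2 using 1
  · funext ω i
    simp [truncNoise]
  · rfl

/-- Integration of the `n`-th noise variable, if only the previous ones are involved otherwise. -/
theorem lintegral_stdNoise_split (n : ℕ) {H : (ℕ → ℝ) → ℝ → ℝ≥0∞}
    (hH : Measurable (Function.uncurry H)) (hdep : ∀ ω x, H (truncNoise n ω) x = H ω x) :
    ∫⁻ ω, H ω (ω n) ∂stdNoise = ∫⁻ ω, ∫⁻ x, H ω x ∂gaussianReal 0 1 ∂stdNoise := by
  have hm : Measurable fun ω : ℕ → ℝ => ω n := measurable_pi_apply n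
  have hlaw := (indepFun_iff_map_prod_eq_prod_map_map (measurable_truncNoise n).aemeasurable
    hm.aemeasurable).1 (indepFun_truncNoise n)
  calc ∫⁻ ω, H ω (ω n) ∂stdNoise
      = ∫⁻ ω, Function.uncurry H (truncNoise n ω, ω n) ∂stdNoise := by
        simp [Function.uncurry, hdep]
    _ = ∫⁻ p, Function.uncurry H p ∂(stdNoise.map (truncNoise n)).prod (gaussianReal 0 1) := by
        rw [← map_eval_stdNoise n, ← hlaw,
          lintegral_map hH ((measurable_truncNoise n).prodMk hm)]
    _ = ∫⁻ ω, ∫⁻ x, H (truncNoise n ω) x ∂gaussianReal 0 1 ∂stdNoise := by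
        rw [lintegral_prod _ hH.aemeasurable, lintegral_map hH.lintegral_prod_right'
          (measurable_truncNoise n)]
        rfl
    _ = _ := by simp [hdep]

theorem AdaptiveInfo.obs_truncNoise {F : Type*} [NormedAddCommGroup F] [NormedSpace ℝ F]
    (N : AdaptiveInfo F) (f : F) (ω : ℕ → ℝ) {n i : ℕ} (hi : i ≤ n) :
    N.obs f (truncNoise n ω) i = N.obs f ω i := by
  induction i with
  | zero => rfl
  | succ i ih =>
    have h : truncNoise n ω i = ω i := by simp [truncNoise, Nat.lt_of_succ_le hi]
    simp only [AdaptiveInfo.obs, ih (Nat.le_of_succ_le hi), h]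

/-- The exponential factor is the density of the Gaussian with mean `δ` relative to the centred one.
-/
theorem lintegral_gaussianReal_add (k : ℝ → ℝ≥0∞) (hk : Measurable k) (δ : ℝ) :
    ∫⁻ x, k (x + δ) ∂gaussianReal 0 1
      = ∫⁻ x, k x * ENNReal.ofReal (Real.exp (δ * x - δ ^ 2 / 2)) ∂gaussianReal 0 1 := by
  have h1 : ∫⁻ x, k (x + δ) ∂gaussianReal 0 1 = ∫⁻ x, k x ∂gaussianReal δ 1 := by
    have := gaussianReal_map_add_const (μ := 0) (v := 1) δ
    rw [zero_add] at this
    rw [← this, lintegral_map hk (by fun_prop)]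
  rw [h1, gaussianReal_of_var_ne_zero _ one_ne_zero, gaussianReal_of_var_ne_zero _ one_ne_zero,
    lintegral_withDensity_eq_lintegral_mul _ (measurable_gaussianPDF _ _) hk,
    lintegral_withDensity_eq_lintegral_mul _ (measurable_gaussianPDF _ _) (by fun_prop)]
  refine lintegral_congr fun x => ?_
  simp only [Pi.mul_apply, gaussianPDF, gaussianPDFReal]
  rw [mul_left_comm, mul_comm (ENNReal.ofReal _) (k x), ← ENNReal.ofReal_mul (by positivity)]
  congr 2
  rw [mul_assoc _ (Real.exp _), ← Real.exp_add]
  congr 2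
  simp
  ring

/-- A Gaussian measure and its translate, compared by the Cauchy–Schwarz inequality. -/
theorem lintegral_gaussianReal_add_sq_le (k : ℝ → ℝ≥0∞) (hk : Measurable k) (δ : ℝ) :
    (∫⁻ x, k (x + δ) ∂gaussianReal 0 1) ^ 2
      ≤ ENNReal.ofReal (Real.exp (δ ^ 2)) * ∫⁻ x, k x ^ 2 ∂gaussianReal 0 1 := by
  set r : ℝ → ℝ≥0∞ := fun x => ENNReal.ofReal (Real.exp (δ * x - δ ^ 2 / 2)) with hr
  have hrm : Measurable r := by fun_prop
  have hCS := ENNReal.lintegral_mul_le_Lp_mul_Lq (gaussianReal 0 1)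
    (Real.HolderConjugate.two_two) hk.aemeasurable hrm.aemeasurable
  -- `r² = exp (-δ²) exp (2δx)`, and the moment generating function at `2δ` is `exp (2δ²)`.
  have hr2 : ∫⁻ x, r x ^ 2 ∂gaussianReal 0 1 = ENNReal.ofReal (Real.exp (δ ^ 2)) := by
    have h1 : ∀ x, r x ^ 2 = ENNReal.ofReal (Real.exp (-δ ^ 2) * Real.exp (2 * δ * x)) := fun x => by
      rw [hr, ← ENNReal.ofReal_pow (Real.exp_pos _).le, ← Real.exp_nat_mul, ← Real.exp_add]
      congr 2
      push_cast
      ring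
    simp only [h1]
    rw [← ofReal_integral_eq_lintegral_ofReal ((integrable_exp_mul_gaussianReal (2 * δ)).const_mul _)
      (ae_of_all _ fun x => by positivity), integral_const_mul]
    have h2 := congrFun (mgf_id_gaussianReal (μ := 0) (v := 1)) (2 * δ)
    simp only [mgf, id] at h2
    rw [h2, ← Real.exp_add]
    congr 2
    simp
    ring
  have h3 : (∫⁻ x, k (x + δ) ∂gaussianReal 0 1)
      ≤ (∫⁻ x, k x ^ 2 ∂gaussianReal 0 1) ^ (1 / 2 : ℝ)
        * ENNReal.ofReal (Real.exp (δ ^ 2)) ^ (1 / 2 : ℝ) := by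
    rw [lintegral_gaussianReal_add k hk, ← hr2]
    simpa using hCS
  calc _ ≤ _ := pow_le_pow_left' h3 2
    _ = _ := by
      rw [mul_pow, ← ENNReal.rpow_natCast, ← ENNReal.rpow_natCast, ← ENNReal.rpow_mul,
        ← ENNReal.rpow_mul]
      simp [mul_comm]

end Noise

/-! ### Comparing the observations of two instances -/

section ChangeOfMeasure

variable {F : Type*} [NormedAddCommGroup F] [NormedSpace ℝ F]

theorem measurable_snoc_affine {X : Type*} [MeasurableSpace X] {n : ℕ} {y : X → Fin n → ℝ}
    {a : X → ℝ} (hy : Measurable y) (ha : Measurable a) :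
    Measurable fun p => (Fin.snoc (α := fun _ => ℝ) (y p) (a p) : Fin (n + 1) → ℝ) := by
  refine measurable_pi_iff.2 fun i => ?_
  refine Fin.lastCases ?_ (fun j => ?_) i
  · simpa only [Fin.snoc_last] using ha
  · simp only [Fin.snoc_castSucc]
    exact (measurable_pi_apply j).comp hy

/-- Comparison of the distributions of the observations of two instances. -/
theorem sq_lintegral_obs_le {N : AdaptiveInfo F} (hN : N.IsMeasurable) (f₁ f₂ : F)
    {δ : (i : ℕ) → (Fin i → ℝ) → ℝ} (hδm : ∀ i, Measurable (δ i))
    (hδ : ∀ i y, N.L i y f₁ - N.L i y f₂ = δ i y * N.σ i y) (n : ℕ) :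
    ∀ g : (Fin n → ℝ) → ℝ≥0∞, Measurable g →
      (∫⁻ ω, g (N.obs f₁ ω n) ∂stdNoise) ^ 2
        ≤ ∫⁻ ω, g (N.obs f₂ ω n) ^ 2 *
          ENNReal.ofReal (Real.exp (∑ i ∈ Finset.range n, δ i (N.obs f₂ ω i) ^ 2)) ∂stdNoise := by
  have hobs : ∀ f i, Measurable fun ω => N.obs f ω i := fun f i =>
    AdaptiveInfo.measurable_obs hN (f := fun _ => f) measurable_id
      (AdaptiveInfo.measurable_eval_const hN f) i
  induction n with
  | zero =>
    intro g _
    simp [AdaptiveInfo.obs]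
  | succ n ih =>
    intro g hg
    have hstep : ∀ f, Measurable fun p : (Fin n → ℝ) × ℝ =>
        (Fin.snoc (α := fun _ => ℝ) p.1 (N.L n p.1 f + (N.σ n p.1 : ℝ) * p.2) :
          Fin (n + 1) → ℝ) := fun f =>
      measurable_snoc_affine measurable_fst (((hN.measurable_L n f).comp measurable_fst).add
        (((hN.measurable_σ n).comp measurable_fst).coe_nnreal_real.mul measurable_snd))
    -- The conditional expectation of `g` for `f₁` given the first `n` observations. Cauchy–Schwarz
    -- is applied conditionally, one observation at a time, so that the random exponent stays inside
    -- the integral.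
    set G : (Fin n → ℝ) → ℝ≥0∞ := fun y =>
      ∫⁻ x, g (Fin.snoc (α := fun _ => ℝ) y (N.L n y f₁ + (N.σ n y : ℝ) * x)) ∂gaussianReal 0 1
      with hG
    have hGm : Measurable G := (hg.comp (hstep f₁)).lintegral_prod_right'
    have h1 : ∫⁻ ω, g (N.obs f₁ ω (n + 1)) ∂stdNoise = ∫⁻ ω, G (N.obs f₁ ω n) ∂stdNoise := by
      refine lintegral_stdNoise_split n (H := fun ω x => g (Fin.snoc (α := fun _ => ℝ)
        (N.obs f₁ ω n) (N.L n (N.obs f₁ ω n) f₁ + (N.σ n (N.obs f₁ ω n) : ℝ) * x))) ?_ ?_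
      · exact hg.comp ((hstep f₁).comp (((hobs f₁ n).comp measurable_fst).prodMk measurable_snd))
      · intro ω x
        rw [N.obs_truncNoise f₁ ω le_rfl]
    have hGle : ∀ y, G y ^ 2 ≤ ENNReal.ofReal (Real.exp (δ n y ^ 2)) *
        ∫⁻ x, g (Fin.snoc (α := fun _ => ℝ) y (N.L n y f₂ + (N.σ n y : ℝ) * x)) ^ 2
          ∂gaussianReal 0 1 := by
      intro y
      have hk : Measurable fun x : ℝ =>
          g (Fin.snoc (α := fun _ => ℝ) y (N.L n y f₂ + (N.σ n y : ℝ) * x)) :=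
        hg.comp ((hstep f₂).comp (measurable_const.prodMk measurable_id))
      -- Replacing `f₂` by `f₁` amounts to shifting the noise variable by `δ n y`.
      refine le_trans (le_of_eq ?_) (lintegral_gaussianReal_add_sq_le _ hk (δ n y))
      rw [hG]
      congr 1
      refine lintegral_congr fun x => ?_
      congr 2
      linear_combination hδ n y
    set E : (ℕ → ℝ) → ℕ → ℝ≥0∞ := fun ω m =>
      ENNReal.ofReal (Real.exp (∑ i ∈ Finset.range m, δ i (N.obs f₂ ω i) ^ 2)) with hE
    have hEm : ∀ m, Measurable fun ω => E ω m := fun m => by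
      refine (Real.measurable_exp.comp (Finset.measurable_sum _ fun i _ => ?_)).ennreal_ofReal
      exact ((hδm i).comp (hobs f₂ i)).pow_const 2
    have hEsucc : ∀ ω, E ω (n + 1) = E ω n * ENNReal.ofReal (Real.exp (δ n (N.obs f₂ ω n) ^ 2)) := by
      intro ω
      rw [hE]
      beta_reduce
      rw [Finset.sum_range_succ, Real.exp_add, ENNReal.ofReal_mul (Real.exp_pos _).le]
    -- The last term is `δ n` at the first `n` observations, so even `E ω (n + 1)` does not involve
    -- the noise variable `ω n`.
    have hEtrunc : ∀ ω, E (truncNoise n ω) (n + 1) = E ω (n + 1) := by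
      intro ω
      rw [hE]
      beta_reduce
      congr 2
      refine Finset.sum_congr rfl fun i hi => ?_
      rw [N.obs_truncNoise f₂ ω (Nat.lt_succ_iff.1 (Finset.mem_range.1 hi))]
    rw [h1]
    refine (ih G hGm).trans ?_
    have h2 : ∫⁻ ω, g (N.obs f₂ ω (n + 1)) ^ 2 * E ω (n + 1) ∂stdNoise
        = ∫⁻ ω, ∫⁻ x, g (Fin.snoc (α := fun _ => ℝ) (N.obs f₂ ω n)
          (N.L n (N.obs f₂ ω n) f₂ + (N.σ n (N.obs f₂ ω n) : ℝ) * x)) ^ 2 * E ω (n + 1)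
          ∂gaussianReal 0 1 ∂stdNoise := by
      refine lintegral_stdNoise_split n (H := fun ω x => g (Fin.snoc (α := fun _ => ℝ)
        (N.obs f₂ ω n) (N.L n (N.obs f₂ ω n) f₂ + (N.σ n (N.obs f₂ ω n) : ℝ) * x)) ^ 2
          * E ω (n + 1)) ?_ ?_
      · exact ((hg.comp ((hstep f₂).comp
          (((hobs f₂ n).comp measurable_fst).prodMk measurable_snd))).pow_const 2).mul
          ((hEm (n + 1)).comp measurable_fst)
      · intro ω x
        simp only [N.obs_truncNoise f₂ ω le_rfl, hEtrunc]
    rw [h2]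
    refine lintegral_mono fun ω => ?_
    rw [lintegral_mul_const' _ _ (by rw [hE]; simp), hEsucc]
    rw [mul_comm (E ω n), ← mul_assoc]
    refine (mul_le_mul_left (hGle (N.obs f₂ ω n)) (E ω n)).trans (le_of_eq ?_)
    ring

end ChangeOfMeasure

end NoisyInfo

namespace NoisyInfo

/-! ### Change of measure up to termination -/

section Stopped

variable {F : Type*} [NormedAddCommGroup F] [NormedSpace ℝ F]

/-- An initial segment of a sequence. -/
def initSeg (y : ℕ → ℝ) (n : ℕ) : Fin n → ℝ := fun i => y i

theorem measurable_initSeg (n : ℕ) : Measurable fun y => initSeg y n :=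
  measurable_pi_iff.2 fun i => measurable_pi_apply (i : ℕ)

/-- Continuation of a finite sequence by zero. -/
noncomputable def extendZero {n : ℕ} (y : Fin n → ℝ) : ℕ → ℝ :=
  fun i => if h : i < n then y ⟨i, h⟩ else 0

theorem measurable_extendZero (n : ℕ) : Measurable (extendZero (n := n)) := by
  refine measurable_pi_iff.2 fun i => ?_
  unfold extendZero
  split_ifs
  · exact measurable_pi_apply _
  · exact measurable_const

theorem AdaptiveInfo.initSeg_extendZero_obs (N : AdaptiveInfo F) (f : F) (ω : ℕ → ℝ) {i n : ℕ}
    (h : i ≤ n) : initSeg (extendZero (N.obs f ω n)) i = N.obs f ω i := by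
  rw [← N.obs_castLE f ω h]
  funext j
  have : (j : ℕ) < n := j.2.trans_le h
  simp [initSeg, extendZero, this, Fin.castLE]

/-- The process has not terminated after the observations `y`, and the next one is noisy. -/
def AdaptiveInfo.Active (N : AdaptiveInfo F) (i : ℕ) (y : Fin i → ℝ) : Prop :=
  (∀ j ≤ i, initSeg (extendZero y) j ∉ N.Y j) ∧ N.σ i y ≠ 0

theorem AdaptiveInfo.measurableSet_active {N : AdaptiveInfo F} (hN : N.IsMeasurable) (i : ℕ) :
    MeasurableSet {y | N.Active i y} := by
  have h1 : {y | N.Active i y} = (⋂ j, ⋂ (_ : j ≤ i),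
      ((fun y => initSeg (extendZero y) j) ⁻¹' N.Y j)ᶜ) ∩ (N.σ i ⁻¹' {0})ᶜ := by
    ext y
    simp [AdaptiveInfo.Active]
  rw [h1]
  refine MeasurableSet.inter (MeasurableSet.iInter fun j => MeasurableSet.iInter fun _ => ?_) ?_
  · exact (((measurable_initSeg j).comp (measurable_extendZero i)) (hN.measurableSet_Y j)).compl
  · exact (hN.measurable_σ i (measurableSet_singleton 0)).compl

open Classical in
/-- The information that evaluates the zero functional once it is not active. -/
noncomputable def AdaptiveInfo.stopped (N : AdaptiveInfo F) : AdaptiveInfo F where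
  L i y := if N.Active i y then N.L i y else 0
  norm_L_le i y := by
    split_ifs
    · exact N.norm_L_le i y
    · simp
  σ := N.σ
  Y := N.Y
  existsUnique_mem := N.existsUnique_mem

open Classical in
theorem AdaptiveInfo.isMeasurable_stopped {N : AdaptiveInfo F} (hN : N.IsMeasurable) :
    N.stopped.IsMeasurable where
  measurable_L i f := by
    have h : (fun y => N.stopped.L i y f) = fun y => if N.Active i y then N.L i y f else 0 := by
      funext y
      simp only [AdaptiveInfo.stopped]
      split_ifs <;> rfl
    rw [h]
    exact Measurable.ite (AdaptiveInfo.measurableSet_active hN i) (hN.measurable_L i f)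
      measurable_const
  measurable_σ := hN.measurable_σ
  measurableSet_Y := hN.measurableSet_Y

theorem AdaptiveInfo.stopped_L_of_active {N : AdaptiveInfo F} {i : ℕ} {y : Fin i → ℝ}
    (h : N.Active i y) : N.stopped.L i y = N.L i y := by
  simp [AdaptiveInfo.stopped, h]

theorem AdaptiveInfo.active_obs_of_lt_numObs (N : AdaptiveInfo F) {f : F} {ω : ℕ → ℝ} {i : ℕ}
    (hi : i < N.numObs f ω) (hσ : N.σ i (N.obs f ω i) ≠ 0) : N.Active i (N.obs f ω i) := by
  refine ⟨fun j hj hmem => ?_, hσ⟩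
  rw [N.initSeg_extendZero_obs f ω hj] at hmem
  have := N.numObs_eq_of_mem hmem
  omega

/-- Activity may be known along either process: as long as the observations agree, it transfers to
the other one, and the next observations agree too. -/
theorem AdaptiveInfo.stopped_obs_eq (N : AdaptiveInfo F) {f : F} {ω : ℕ → ℝ} {n : ℕ}
    (h : (∀ i < n, N.Active i (N.obs f ω i)) ∨ ∀ i < n, N.Active i (N.stopped.obs f ω i)) :
    ∀ i ≤ n, N.stopped.obs f ω i = N.obs f ω i := by
  intro i
  induction i with
  | zero => exact fun _ => rfl
  | succ i ih =>
    intro hi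
    have h1 := ih (Nat.le_of_succ_le hi)
    have hact : N.Active i (N.obs f ω i) := by
      rcases h with h | h
      · exact h i hi
      · exact h1 ▸ h i hi
    simp only [AdaptiveInfo.obs, h1, AdaptiveInfo.stopped_L_of_active hact]
    rfl

/-- For an event that is determined by the observations before termination, and such that the
accumulated information `∑ σᵢ⁻²` is bounded on it, the probabilities for two instances are
comparable. -/
theorem sq_stdNoise_le_exp_mul {N : AdaptiveInfo F} (hN : N.IsMeasurable) {f₁ f₂ : F} {h J : ℝ}
    (hf : ∀ i y, |N.L i y f₁ - N.L i y f₂| ≤ h)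
    {Q : ℕ → Set (ℕ → ℝ)} (hQm : ∀ n, MeasurableSet {y : ℕ → ℝ | y ∈ Q n})
    (hQseg : ∀ n y z, initSeg y n = initSeg z n → y ∈ Q n → z ∈ Q n)
    (hQY : ∀ n y, y ∈ Q n → initSeg y n ∈ N.Y n)
    (hQσ : ∀ n y, y ∈ Q n → ∀ i < n, N.σ i (initSeg y i) ≠ 0)
    (hQJ : ∀ n y, y ∈ Q n →
      ∑ i ∈ Finset.range n, ((N.σ i (initSeg y i) : ℝ) ^ 2)⁻¹ ≤ J) (K : ℕ) :
    stdNoise {ω | ∃ n ≤ K, extendZero (N.obs f₁ ω K) ∈ Q n} ^ 2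
      ≤ ENNReal.ofReal (Real.exp (h ^ 2 * J)) *
        stdNoise {ω | ∃ n ≤ K, extendZero (N.obs f₂ ω K) ∈ Q n} := by
  classical
  -- The comparison runs up to the fixed horizon `K`, but `J` controls the precisions only before
  -- termination, and an exact observation admits no noise shift. The zero functional makes the
  -- shift vanish in both cases.
  set M := N.stopped with hM
  have hMm : M.IsMeasurable := AdaptiveInfo.isMeasurable_stopped hN
  have hext : ∀ (N' : AdaptiveInfo F) f ω n, n ≤ K →
      (extendZero (N'.obs f ω K) ∈ Q n ↔ extendZero (N'.obs f ω n) ∈ Q n) := by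
    intro N' f ω n hn
    have : initSeg (extendZero (N'.obs f ω K)) n = initSeg (extendZero (N'.obs f ω n)) n := by
      rw [N'.initSeg_extendZero_obs f ω hn, N'.initSeg_extendZero_obs f ω le_rfl]
    exact ⟨hQseg n _ _ this, hQseg n _ _ this.symm⟩
  have hact : ∀ (N' : AdaptiveInfo F) (_ : N'.Y = N.Y) (_ : N'.σ = N.σ) f ω n,
      extendZero (N'.obs f ω n) ∈ Q n → ∀ i < n, N.Active i (N'.obs f ω i) := by
    intro N' hY hσ f ω n hmem i hi
    have h1 := hQY n _ hmem
    rw [N'.initSeg_extendZero_obs f ω le_rfl, ← hY] at h1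
    have h2 := N'.numObs_eq_of_mem h1
    have h3 := hQσ n _ hmem i hi
    rw [N'.initSeg_extendZero_obs f ω hi.le, ← hσ] at h3
    have h4 := N'.active_obs_of_lt_numObs (h2 ▸ hi) h3
    simpa only [AdaptiveInfo.Active, hY, hσ] using h4
  -- Paths in the event are active until they terminate, so stopping does not change it.
  have hiff : ∀ f ω, (∃ n ≤ K, extendZero (N.obs f ω K) ∈ Q n) ↔
      ∃ n ≤ K, extendZero (M.obs f ω K) ∈ Q n := by
    intro f ω
    refine exists_congr fun n => and_congr_right fun hn => ?_
    rw [hext N f ω n hn, hext M f ω n hn]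
    constructor
    · intro hmem
      rwa [N.stopped_obs_eq (Or.inl (hact N rfl rfl f ω n hmem)) n le_rfl]
    · intro hmem
      rwa [← N.stopped_obs_eq (Or.inr (hact M rfl rfl f ω n hmem)) n le_rfl]
  simp only [hiff]
  set B : Set (Fin K → ℝ) := {y | ∃ n ≤ K, extendZero y ∈ Q n} with hB
  have hBm : MeasurableSet B := by
    have : B = ⋃ n, ⋃ (_ : n ≤ K), extendZero ⁻¹' Q n := by
      ext y
      simp [hB]
    rw [this]
    exact MeasurableSet.iUnion fun n => MeasurableSet.iUnion fun _ =>
      measurable_extendZero K (hQm n)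
  set δ : (i : ℕ) → (Fin i → ℝ) → ℝ := fun i y => (M.L i y f₁ - M.L i y f₂) / N.σ i y with hδ
  have hδm : ∀ i, Measurable (δ i) := fun i =>
    ((hMm.measurable_L i f₁).sub (hMm.measurable_L i f₂)).div
      (hN.measurable_σ i).coe_nnreal_real
  have hinact : ∀ i y, ¬ N.Active i y → M.L i y = 0 := fun i y hy => by
    simp [hM, AdaptiveInfo.stopped, hy]
  have hδσ : ∀ i y, M.L i y f₁ - M.L i y f₂ = δ i y * M.σ i y := by
    intro i y
    by_cases hy : N.Active i y
    · have : (N.σ i y : ℝ) ≠ 0 := by exact_mod_cast hy.2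
      rw [hδ]
      exact (div_mul_cancel₀ _ this).symm
    · simp [hδ, hinact i y hy]
  have hsum : ∀ ω, M.obs f₂ ω K ∈ B →
      ∑ i ∈ Finset.range K, δ i (M.obs f₂ ω i) ^ 2 ≤ h ^ 2 * J := by
    rintro ω ⟨n, hn, hmem⟩
    rw [hext M f₂ ω n hn] at hmem
    have hY := hQY n _ hmem
    have hle := hQJ n _ hmem
    rw [M.initSeg_extendZero_obs f₂ ω le_rfl] at hY
    have hzero : ∀ i ∈ Finset.range K, i ∉ Finset.range n → δ i (M.obs f₂ ω i) ^ 2 = 0 := by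
      intro i _ hi
      have hni : n ≤ i := by simpa using hi
      have : ¬ N.Active i (M.obs f₂ ω i) := fun h => h.1 n hni (by
        rwa [M.initSeg_extendZero_obs f₂ ω hni])
      simp [hδ, hinact i _ this]
    rw [← Finset.sum_subset (Finset.range_mono hn) hzero]
    calc ∑ i ∈ Finset.range n, δ i (M.obs f₂ ω i) ^ 2
        ≤ ∑ i ∈ Finset.range n, h ^ 2 * ((N.σ i (M.obs f₂ ω i) : ℝ) ^ 2)⁻¹ := by
          refine Finset.sum_le_sum fun i hi => ?_
          have ha := hact M rfl rfl f₂ ω n hmem i (Finset.mem_range.1 hi)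
          rw [hδ]
          beta_reduce
          rw [div_pow, div_eq_mul_inv, AdaptiveInfo.stopped_L_of_active ha, ← sq_abs]
          gcongr
          exact hf _ _
      _ = h ^ 2 * ∑ i ∈ Finset.range n, ((N.σ i (M.obs f₂ ω i) : ℝ) ^ 2)⁻¹ := by
          rw [Finset.mul_sum]
      _ ≤ h ^ 2 * J := by
          refine mul_le_mul_of_nonneg_left (le_trans (le_of_eq ?_) hle) (sq_nonneg h)
          refine Finset.sum_congr rfl fun i hi => ?_
          rw [M.initSeg_extendZero_obs f₂ ω (Finset.mem_range.1 hi).le]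
  have hobs : ∀ f, Measurable fun ω => M.obs f ω K := fun f =>
    AdaptiveInfo.measurable_obs hMm (f := fun _ => f) measurable_id
      (AdaptiveInfo.measurable_eval_const hMm f) K
  have hind : ∀ f, ∫⁻ ω, B.indicator 1 (M.obs f ω K) ∂stdNoise
      = stdNoise {ω | ∃ n ≤ K, extendZero (M.obs f ω K) ∈ Q n} := fun f => by
    exact Eq.trans rfl (lintegral_indicator_one ((hobs f) hBm))
  have key := sq_lintegral_obs_le hMm f₁ f₂ hδm hδσ K (B.indicator 1)
    (measurable_one.indicator hBm)
  rw [hind] at key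
  refine key.trans ?_
  rw [← hind f₂, ← lintegral_const_mul' _ _ (by simp)]
  refine lintegral_mono fun ω => ?_
  by_cases hω : M.obs f₂ ω K ∈ B
  · simp only [Set.indicator_of_mem hω, Pi.one_apply, one_pow, one_mul, mul_one]
    exact ENNReal.ofReal_le_ofReal (Real.exp_le_exp.2 (hsum ω hω))
  · simp [Set.indicator_of_notMem hω]

end Stopped

end NoisyInfo

namespace NoisyInfo

/-! ### A cheap path with high precision -/

section CheapPath

variable {F G : Type*} [NormedAddCommGroup F] [NormedSpace ℝ F]
  [NormedAddCommGroup G] [NormedSpace ℝ G]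

/-- Large errors are rare. -/
theorem stdNoise_large_error_le {S : F →L[ℝ] G} {K : Set F} {N : AdaptiveInfo F}
    {Φ : Algorithm G} (hN : N.IsMeasurable) (hΦ : ∀ n, StronglyMeasurable (Φ n)) {r t : ℝ≥0∞}
    (hr0 : r ≠ 0) (hrT : r ≠ ∞) (h : errWA S K N Φ ≤ r) (ht : 4 * r ≤ t) {f : F} (hf : f ∈ K) :
    stdNoise {ω | t ≤ ‖S f - output N Φ f ω‖ₑ} ≤ 1 / 16 := by
  have hm : Measurable fun ω => ‖S f - output N Φ f ω‖ₑ ^ 2 :=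
    (measurable_enorm_sub_output hN hΦ (f := fun _ => f) measurable_id
      (AdaptiveInfo.measurable_eval_const hN f) stronglyMeasurable_const).pow_const 2
  have h1 := mul_meas_ge_le_lintegral₀ (μ := stdNoise) hm.aemeasurable ((4 * r) ^ 2)
  have h2 : stdNoise {ω | t ≤ ‖S f - output N Φ f ω‖ₑ}
      ≤ stdNoise {ω | (4 * r) ^ 2 ≤ ‖S f - output N Φ f ω‖ₑ ^ 2} :=
    measure_mono fun ω hω => pow_le_pow_left' (ht.trans hω) 2
  refine h2.trans ?_
  rw [ENNReal.le_div_iff_mul_le (by simp) (by simp)]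
  have h3 : r ^ 2 * (stdNoise {ω | (4 * r) ^ 2 ≤ ‖S f - output N Φ f ω‖ₑ ^ 2} * 16)
      ≤ r ^ 2 * 1 := by
    calc _ = (4 * r) ^ 2 * stdNoise {ω | (4 * r) ^ 2 ≤ ‖S f - output N Φ f ω‖ₑ ^ 2} := by ring
      _ ≤ _ := h1
      _ ≤ r ^ 2 := lintegral_sq_le_of_errWA_le h hf
      _ = r ^ 2 * 1 := (mul_one _).symm
  exact (ENNReal.mul_le_mul_iff_right (pow_ne_zero 2 hr0) (ENNReal.pow_ne_top hrT)).1 h3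

theorem measurable_sum_cost_obs {N : AdaptiveInfo F} (hN : N.IsMeasurable) {cost : ℝ≥0 → ℝ≥0∞}
    (hcost : Measurable cost) (f : F) :
    Measurable fun ω => ∑ i ∈ Finset.range (N.numObs f ω), cost (N.σ i (N.obs f ω i)) := by
  have hobs := AdaptiveInfo.measurable_obs hN (f := fun _ : ℕ → ℝ => f) measurable_id
    (AdaptiveInfo.measurable_eval_const hN f)
  exact AdaptiveInfo.measurable_numObs_comp hN (f := fun _ : ℕ → ℝ => f) measurable_id
    (AdaptiveInfo.measurable_eval_const hN f)
    (u := fun n ω => ∑ i ∈ Finset.range n, cost (N.σ i (N.obs f ω i)))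
    fun n => Finset.measurable_sum _ fun i _ =>
      hcost.comp ((hN.measurable_σ i).comp (hobs i))

/-- If the error is at most `ε ‖S‖`, then on some path whose cost is at most twice the cost of the
information, the precisions are high enough for approximating a real parameter. -/
theorem exists_cheap_precise_path {S : F →L[ℝ] G} (hS : S ≠ 0) {N : AdaptiveInfo F}
    {Φ : Algorithm G} (hN : N.IsMeasurable) (hΦ : ∀ n, StronglyMeasurable (Φ n))
    {cost : ℝ≥0 → ℝ≥0∞} (hcost : Measurable cost) {ε : ℝ≥0} (hε0 : 0 < ε) (hε : 8 * ε ≤ 1)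
    (herr : errWA S (Metric.closedBall 0 1) N Φ ≤ ε * ‖S‖ₑ)
    (hC0 : costWA cost (Metric.closedBall 0 1) N ≠ 0)
    (hCT : costWA cost (Metric.closedBall 0 1) N ≠ ∞) :
    ∃ (y : ℕ → ℝ) (n : ℕ),
      ∑ i ∈ Finset.range n, cost (N.σ i (initSeg y i))
        ≤ 2 * costWA cost (Metric.closedBall 0 1) N ∧
      ((∃ i < n, N.σ i (initSeg y i) = 0) ∨
        (256 * (ε : ℝ) ^ 2)⁻¹ < ∑ i ∈ Finset.range n, ((N.σ i (initSeg y i) : ℝ) ^ 2)⁻¹) := by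
  set C := costWA cost (Metric.closedBall (0 : F) 1) N with hC
  by_contra! hno
  have hS0 : 0 < ‖S‖ := norm_pos_iff.2 hS
  obtain ⟨x, hx1, hx⟩ := S.exists_lt_apply_of_lt_opNorm (half_lt_self hS0)
  -- Since `‖S x‖ > ‖S‖ / 2`, this gives `‖S f‖ ≥ 4ε‖S‖`, four times the permitted error, while `f`
  -- and `-f` stay in the ball.
  set f : F := (8 * ε : ℝ) • x with hf
  have hf1 : ‖f‖ ≤ 1 := by
    have hε' : (8 * ε : ℝ) ≤ 1 := by exact_mod_cast hε
    rw [hf, norm_smul, Real.norm_of_nonneg (by positivity)]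
    have := norm_nonneg x
    have : (0 : ℝ) ≤ 8 * ε := by positivity
    nlinarith
  have hfmem : f ∈ Metric.closedBall (0 : F) 1 := by simpa using hf1
  have hfmem' : -f ∈ Metric.closedBall (0 : F) 1 := by simpa using hf1
  have hL : ∀ i y, |N.L i y f - N.L i y (-f)| ≤ 16 * ε := by
    intro i y
    have h1 : N.L i y f - N.L i y (-f) = 16 * ε * N.L i y x := by
      rw [map_neg, hf, map_smul, smul_eq_mul]
      ring
    have h2 : |N.L i y x| ≤ 1 := by
      have h3 := (N.L i y).le_opNorm x
      have h4 := N.norm_L_le i y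
      rw [Real.norm_eq_abs] at h3
      nlinarith [norm_nonneg x, norm_nonneg (N.L i y)]
    rw [h1, abs_mul, abs_of_nonneg (by positivity)]
    exact mul_le_of_le_one_right (by positivity) h2
  set u := S f with hu
  set r : ℝ≥0∞ := ε * ‖S‖ₑ with hr
  have hr0 : r ≠ 0 := by
    rw [hr]
    have hS1 : ‖S‖ₑ ≠ 0 := by
      rw [← ofReal_norm, Ne, ENNReal.ofReal_eq_zero, not_le]
      exact hS0
    exact mul_ne_zero (by simpa using hε0.ne') hS1
  have hrT : r ≠ ∞ := by
    rw [hr]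
    finiteness
  have hru : 4 * r ≤ ‖u‖ₑ := by
    have h1 : ‖u‖ = 8 * ε * ‖S x‖ := by
      rw [hu, hf, map_smul, norm_smul, Real.norm_of_nonneg (by positivity)]
    have h2 : 4 * (ε * ‖S‖) ≤ ‖u‖ := by
      rw [h1]
      have : (0 : ℝ) < ε := hε0
      nlinarith
    rw [hr, enorm_eq_nnnorm, enorm_eq_nnnorm]
    exact_mod_cast h2
  -- This event is likely for `f`. For `-f` it is rare: an output at distance less than `‖u‖` from
  -- `u` is farther than `‖u‖` from `-u`.
  set Q : ℕ → Set (ℕ → ℝ) := fun n => {y | initSeg y n ∈ N.Y n ∧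
    ∑ i ∈ Finset.range n, cost (N.σ i (initSeg y i)) ≤ 2 * C ∧
    ‖u - Φ n (initSeg y n)‖ₑ < ‖u‖ₑ} with hQ
  have hQm : ∀ n, MeasurableSet {y : ℕ → ℝ | y ∈ Q n} := by
    intro n
    have h1 : Measurable fun y : ℕ → ℝ =>
        ∑ i ∈ Finset.range n, cost (N.σ i (initSeg y i)) :=
      Finset.measurable_sum _ fun i _ =>
        hcost.comp ((hN.measurable_σ i).comp (measurable_initSeg i))
    have h2 : Measurable fun y : ℕ → ℝ => ‖u - Φ n (initSeg y n)‖ₑ :=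
      (stronglyMeasurable_const.sub ((hΦ n).comp_measurable (measurable_initSeg n))).enorm
    exact (measurable_initSeg n (hN.measurableSet_Y n)).inter
      ((measurableSet_le h1 measurable_const).inter (measurableSet_lt h2 measurable_const))
  have hQseg : ∀ n y z, initSeg y n = initSeg z n → y ∈ Q n → z ∈ Q n := by
    rintro n y z hyz ⟨h1, h2, h3⟩
    have h4 : ∀ i ∈ Finset.range n, initSeg y i = initSeg z i := fun i hi => funext fun j =>
      congrFun hyz ⟨j, j.2.trans (Finset.mem_range.1 hi)⟩
    refine ⟨hyz ▸ h1, le_trans (le_of_eq (Finset.sum_congr rfl fun i hi => ?_)) h2, hyz ▸ h3⟩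
    rw [h4 i hi]
  have hmem : ∀ g ω n K, n ≤ K → (extendZero (N.obs g ω K) ∈ Q n ↔ N.obs g ω n ∈ N.Y n ∧
      ∑ i ∈ Finset.range n, cost (N.σ i (N.obs g ω i)) ≤ 2 * C ∧
      ‖u - Φ n (N.obs g ω n)‖ₑ < ‖u‖ₑ) := by
    intro g ω n K hn
    have h1 : ∑ i ∈ Finset.range n, cost (N.σ i (initSeg (extendZero (N.obs g ω K)) i))
        = ∑ i ∈ Finset.range n, cost (N.σ i (N.obs g ω i)) :=
      Finset.sum_congr rfl fun i hi => by
        rw [N.initSeg_extendZero_obs g ω ((Finset.mem_range.1 hi).le.trans hn)]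
    simp only [hQ, Set.mem_ofPred_eq, h1, N.initSeg_extendZero_obs g ω hn]
  have hcmp := sq_stdNoise_le_exp_mul hN hL hQm hQseg (fun n y hy => hy.1)
    (fun n y hy => (hno y n hy.2.1).1) (fun n y hy => (hno y n hy.2.1).2)
  -- The threshold `1/(256 ε²)` is chosen to make the exponent `1`.
  have hexp : ((16 * ε : ℝ) ^ 2 * (256 * (ε : ℝ) ^ 2)⁻¹) = 1 := by
    have : (ε : ℝ) ≠ 0 := by exact_mod_cast hε0.ne'
    field_simp
    norm_num
  rw [hexp] at hcmp
  set A : ℕ → Set (ℕ → ℝ) := fun K => {ω | ∃ n ≤ K, extendZero (N.obs f ω K) ∈ Q n} with hA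
  have hneg : ∀ K, stdNoise {ω | ∃ n ≤ K, extendZero (N.obs (-f) ω K) ∈ Q n} ≤ 1 / 16 := by
    intro K
    refine le_trans (measure_mono ?_)
      (stdNoise_large_error_le hN hΦ hr0 hrT herr hru hfmem')
    rintro ω ⟨n, hn, hω⟩
    obtain ⟨h1, -, h3⟩ := (hmem _ ω n K hn).1 hω
    have h4 : output N Φ (-f) ω = Φ n (N.obs (-f) ω n) := by
      rw [output, N.numObs_eq_of_mem h1]
    rw [Set.mem_ofPred_eq, h4, map_neg, ← hu]
    have h5 : ‖u - Φ n (N.obs (-f) ω n)‖ < ‖u‖ := by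
      rw [enorm_eq_nnnorm, enorm_eq_nnnorm] at h3
      exact_mod_cast h3
    have h6 : (2 : ℝ) * ‖u‖ ≤ ‖u - Φ n (N.obs (-f) ω n)‖ + ‖-u - Φ n (N.obs (-f) ω n)‖ := by
      rw [← Real.norm_two, ← norm_smul]
      refine le_trans (le_of_eq ?_) (norm_sub_le _ _)
      congr 1
      rw [two_smul]
      abel
    have h7 : ‖u‖ ≤ ‖-u - Φ n (N.obs (-f) ω n)‖ := by linarith
    rw [enorm_eq_nnnorm, enorm_eq_nnnorm]
    exact_mod_cast h7
  -- The square root of `e/16` is less than `0.42`.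
  have hAle : ∀ K, stdNoise (A K) ≤ ENNReal.ofReal (42 / 100) := by
    intro K
    have h1 : stdNoise (A K) ^ 2 ≤ ENNReal.ofReal (42 / 100) ^ 2 := by
      calc stdNoise (A K) ^ 2 ≤ ENNReal.ofReal (Real.exp 1) * (1 / 16) :=
            (hcmp K).trans (by gcongr; exact hneg K)
        _ = ENNReal.ofReal (Real.exp 1 * (1 / 16)) := by
            rw [ENNReal.ofReal_mul (Real.exp_pos _).le, ENNReal.ofReal_div_of_pos (by norm_num)]
            simp
        _ ≤ ENNReal.ofReal ((42 / 100) ^ 2) := by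
            refine ENNReal.ofReal_le_ofReal ?_
            have := Real.exp_one_lt_d9
            norm_num at this ⊢
            linarith
        _ = _ := ENNReal.ofReal_pow (by norm_num) 2
    exact (ENNReal.pow_le_pow_left_iff two_ne_zero).1 h1
  have hmono : Monotone A := by
    rintro K K' hK ω ⟨n, hn, hω⟩
    exact ⟨n, hn.trans hK, (hmem f ω n K' (hn.trans hK)).2 ((hmem f ω n K hn).1 hω)⟩
  have hAU : stdNoise (⋃ K, A K) ≤ ENNReal.ofReal (42 / 100) := by
    rw [hmono.measure_iUnion]
    exact iSup_le hAle
  have hcostm := measurable_sum_cost_obs hN hcost f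
  have hbig : stdNoise {ω | 2 * C ≤ ∑ i ∈ Finset.range (N.numObs f ω), cost (N.σ i (N.obs f ω i))}
      ≤ 1 / 2 := by
    have h1 := mul_meas_ge_le_lintegral₀ (μ := stdNoise) hcostm.aemeasurable (2 * C)
    have h2 := h1.trans (lintegral_le_costWA cost (Metric.closedBall 0 1) N hfmem)
    rw [ENNReal.le_div_iff_mul_le (by simp) (by simp)]
    rw [← ENNReal.mul_le_mul_iff_right hC0 hCT, mul_one]
    refine le_trans (le_of_eq ?_) h2
    ring
  have herrle := stdNoise_large_error_le hN hΦ hr0 hrT herr hru hfmem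
  -- Every path is cheap and accurate, or expensive, or inaccurate; the probabilities for `f` are at
  -- most `0.42`, `1/2` and `1/16`, with sum `0.9825 < 1`.
  have hcover : (Set.univ : Set (ℕ → ℝ)) ⊆ ((⋃ K, A K) ∪
      {ω | 2 * C ≤ ∑ i ∈ Finset.range (N.numObs f ω), cost (N.σ i (N.obs f ω i))}) ∪
      {ω | ‖u‖ₑ ≤ ‖u - output N Φ f ω‖ₑ} := by
    intro ω _
    by_cases h2 : 2 * C ≤ ∑ i ∈ Finset.range (N.numObs f ω), cost (N.σ i (N.obs f ω i))
    · exact Or.inl (Or.inr h2)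
    by_cases h3 : ‖u‖ₑ ≤ ‖u - output N Φ f ω‖ₑ
    · exact Or.inr h3
    refine Or.inl (Or.inl (Set.mem_iUnion.2 ⟨N.numObs f ω, N.numObs f ω, le_rfl, ?_⟩))
    exact (hmem f ω _ _ le_rfl).2 ⟨N.obs_numObs_mem f ω, (not_le.1 h2).le, not_le.1 h3⟩
  have h1 : (1 : ℝ≥0∞) ≤ ENNReal.ofReal (42 / 100) + 1 / 2 + 1 / 16 := by
    calc (1 : ℝ≥0∞) = stdNoise Set.univ := measure_univ.symm
      _ ≤ _ := measure_mono hcover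
      _ ≤ _ := (measure_union_le _ _).trans (add_le_add_left (measure_union_le _ _) _)
      _ ≤ _ := add_le_add (add_le_add hAU hbig) herrle
  have h2 : ENNReal.ofReal (42 / 100) + 1 / 2 + 1 / 16
      = ENNReal.ofReal (42 / 100 + 1 / 2 + 1 / 16) := by
    rw [ENNReal.ofReal_add (by norm_num) (by norm_num),
      ENNReal.ofReal_add (by norm_num) (by norm_num),
      ENNReal.ofReal_div_of_pos (x := 1) (y := 2) (by norm_num),
      ENNReal.ofReal_div_of_pos (x := 1) (y := 16) (by norm_num)]
    simp
  rw [h2, ENNReal.one_le_ofReal] at h1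
  norm_num at h1

end CheapPath

/-! ### Nonadaptive estimation of a real parameter -/

section AuxCost

/-- Nonadaptive observations of a real parameter, with precisions `τ 0, …, τ (n - 1)`. -/
noncomputable def realInfo (τ : ℕ → ℝ≥0) (n : ℕ) : AdaptiveInfo ℝ where
  L _ _ := ContinuousLinearMap.id ℝ ℝ
  norm_L_le _ _ := ContinuousLinearMap.norm_id_le
  σ i _ := τ i
  Y m := {_y | m = n}
  existsUnique_mem _ := ⟨n, rfl, fun _ h => h⟩

theorem variance_eval_stdNoise (i : ℕ) : Var[fun ω : ℕ → ℝ => ω i; stdNoise] = 1 := by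
  have h := variance_map (X := id) (Y := fun ω : ℕ → ℝ => ω i) (μ := stdNoise)
    measurable_id.aemeasurable (measurable_pi_apply i).aemeasurable
  rw [map_eval_stdNoise, variance_id_gaussianReal] at h
  exact h.symm.trans (by simp)

theorem memLp_eval_stdNoise (i : ℕ) : MemLp (fun ω : ℕ → ℝ => ω i) 2 stdNoise := by
  have h : MemLp (id : ℝ → ℝ) 2 (stdNoise.map fun ω : ℕ → ℝ => ω i) := by
    rw [map_eval_stdNoise]
    exact memLp_id_gaussianReal 2
  exact h.comp_of_map (measurable_pi_apply i).aemeasurable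

theorem integral_eval_stdNoise (i : ℕ) : ∫ ω, ω i ∂stdNoise = 0 := by
  have h := integral_map (μ := stdNoise) (φ := fun ω : ℕ → ℝ => ω i) (f := id)
    (measurable_pi_apply i).aemeasurable aestronglyMeasurable_id
  rw [map_eval_stdNoise] at h
  simpa [integral_id_gaussianReal] using h.symm

theorem lintegral_sq_sum_noise (n : ℕ) (a : ℕ → ℝ) :
    ∫⁻ ω, ‖∑ i ∈ Finset.range n, a i * ω i‖ₑ ^ 2 ∂stdNoise
      = ENNReal.ofReal (∑ i ∈ Finset.range n, a i ^ 2) := by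
  have hLp : ∀ i, MemLp (fun ω : ℕ → ℝ => a i * ω i) 2 stdNoise := fun i =>
    (memLp_eval_stdNoise i).const_mul (a i)
  have hsum : MemLp (fun ω : ℕ → ℝ => ∑ i ∈ Finset.range n, a i * ω i) 2 stdNoise :=
    memLp_finsetSum _ fun i _ => hLp i
  have hmean : ∫ ω, ∑ i ∈ Finset.range n, a i * ω i ∂stdNoise = 0 := by
    rw [integral_finsetSum _ fun i _ => (hLp i).integrable (by norm_num)]
    simp [integral_const_mul, integral_eval_stdNoise]
  have hind : iIndepFun (fun (i : ℕ) (ω : ℕ → ℝ) => a i * ω i) stdNoise :=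
    iIndepFun_stdNoise.comp (fun i x => a i * x) fun i => by fun_prop
  have hvar : Var[fun ω : ℕ → ℝ => ∑ i ∈ Finset.range n, a i * ω i; stdNoise]
      = ∑ i ∈ Finset.range n, a i ^ 2 := by
    have h := IndepFun.variance_sum (X := fun (i : ℕ) (ω : ℕ → ℝ) => a i * ω i)
      (s := Finset.range n) (μ := stdNoise) (fun i _ => hLp i)
      fun i _ j _ hij => hind.indepFun hij
    have h' : (∑ i ∈ Finset.range n, fun ω : ℕ → ℝ => a i * ω i)
        = fun ω => ∑ i ∈ Finset.range n, a i * ω i := by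
      funext ω
      simp
    rw [h'] at h
    rw [h]
    refine Finset.sum_congr rfl fun i _ => ?_
    rw [variance_const_mul, variance_eval_stdNoise, mul_one]
  rw [← hvar, hsum.ofReal_variance_eq, evariance]
  simp [hmean]

/-- A weighted mean of nonadaptive observations. -/
theorem auxCost_le_sum (cost : ℝ≥0 → ℕ+ → ℝ≥0∞) (s : ℝ≥0) (d : ℕ+) (τ : ℕ → ℝ≥0) (n : ℕ)
    (a : ℕ → ℝ) (ha : ∑ i ∈ Finset.range n, a i = 1)
    (hs : ∑ i ∈ Finset.range n, (a i * τ i) ^ 2 ≤ (s : ℝ) ^ 2) :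
    auxCost cost s d ≤ ∑ i ∈ Finset.range n, cost (τ i) d := by
  set N := realInfo τ n with hN
  have hnum : ∀ f ω, N.numObs f ω = n := fun f ω => N.numObs_eq_of_mem (show n = n from rfl)
  have hobs : ∀ f ω (i : Fin n), N.obs f ω n i = f + τ i * ω i := fun f ω i => by
    rw [N.obs_eq]
    simp only [AdaptiveInfo.obs, Fin.snoc_last]
    simp [hN, realInfo]
  have hout : ∀ f ω, output N (fun m y => ∑ i : Fin m, a i * y i) f ω
      = f + ∑ i ∈ Finset.range n, a i * τ i * ω i := fun f ω => by
    rw [output, hnum f ω]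
    simp only [hobs]
    rw [Fin.sum_univ_eq_sum_range (fun i => a i * (f + τ i * ω i)) n]
    simp only [mul_add, Finset.sum_add_distrib, ← Finset.sum_mul, ha, one_mul, mul_assoc]
  refine sInf_le_of_le ⟨N, fun m y => ∑ i : Fin m, a i * y i, fun _ _ => rfl,
    ⟨fun i f => measurable_const, fun i => measurable_const, fun m => ?_⟩, fun m => ?_, ?_, rfl⟩ ?_
  · exact MeasurableSet.const (m = n)
  · exact (by fun_prop : Continuous fun y : Fin m → ℝ => ∑ i : Fin m, a i * y i).stronglyMeasurable
  · refine iSup₂_le fun f _ => ?_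
    have h1 : ∫⁻ ω, ‖ContinuousLinearMap.id ℝ ℝ f -
        output N (fun m y => ∑ i : Fin m, a i * y i) f ω‖ₑ ^ 2 ∂stdNoise ≤ (s : ℝ≥0∞) ^ 2 := by
      simp only [hout, ContinuousLinearMap.id_apply, sub_add_cancel_left, enorm_neg]
      rw [lintegral_sq_sum_noise n fun i => a i * τ i, ← ENNReal.ofReal_coe_nnreal,
        ← ENNReal.ofReal_pow s.coe_nonneg]
      exact ENNReal.ofReal_le_ofReal hs
    refine (ENNReal.rpow_le_rpow h1 (by norm_num)).trans (le_of_eq ?_)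
    rw [← ENNReal.rpow_natCast, ← ENNReal.rpow_mul]
    simp
  · refine iSup₂_le fun f _ => ?_
    simp only [hnum]
    simp [hN, realInfo]

/-- An exact observation receives all the weight. Otherwise weights proportional to `(τ i)⁻²` give
variance `1 / ∑ (τ i)⁻²`. -/
theorem auxCost_le_sum_of_precise (cost : ℝ≥0 → ℕ+ → ℝ≥0∞) {s : ℝ≥0} (hs0 : 0 < s) (d : ℕ+)
    (τ : ℕ → ℝ≥0) (n : ℕ)
    (hs : (∃ i < n, τ i = 0) ∨ ((s : ℝ) ^ 2)⁻¹ ≤ ∑ i ∈ Finset.range n, ((τ i : ℝ) ^ 2)⁻¹) :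
    auxCost cost s d ≤ ∑ i ∈ Finset.range n, cost (τ i) d := by
  by_cases hz : ∃ i < n, τ i = 0
  · obtain ⟨j, hj, hτ⟩ := hz
    refine auxCost_le_sum cost s d τ n (Pi.single j 1) ?_ ?_
    · simp [Pi.single_apply, hj]
    · rw [Finset.sum_eq_zero]
      · positivity
      · intro i _
        rcases eq_or_ne i j with rfl | hij
        · simp [hτ]
        · simp [Pi.single_eq_of_ne hij]
  · have hle := hs.resolve_left hz
    push Not at hz
    set I := ∑ i ∈ Finset.range n, ((τ i : ℝ) ^ 2)⁻¹ with hI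
    have hs0' : (0 : ℝ) < s := hs0
    have hI0 : 0 < I := lt_of_lt_of_le (by positivity) hle
    refine auxCost_le_sum cost s d τ n (fun i => ((τ i : ℝ) ^ 2)⁻¹ / I) ?_ ?_
    · rw [← Finset.sum_div, div_self hI0.ne']
    · have h1 : ∀ i ∈ Finset.range n,
          (((τ i : ℝ) ^ 2)⁻¹ / I * τ i) ^ 2 = ((τ i : ℝ) ^ 2)⁻¹ / I ^ 2 := by
        intro i hi
        have : (τ i : ℝ) ≠ 0 := by exact_mod_cast hz i (Finset.mem_range.1 hi)
        field_simp
      rw [Finset.sum_congr rfl h1, ← Finset.sum_div, ← hI]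
      have h2 : I / I ^ 2 = I⁻¹ := by field_simp
      rw [h2]
      exact inv_le_of_inv_le₀ (by positivity) hle

end AuxCost

/-! ### The bound by the auxiliary cost function -/

section SecondBound

variable {F G : Type*} [NormedAddCommGroup F] [InnerProductSpace ℝ F]
  [NormedAddCommGroup G] [InnerProductSpace ℝ G]

/-- The precisions along a single cheap path form a fixed list, which serves for every real
parameter at cost at most `2C`. -/
theorem auxCost_div_two_le_compWA {S : F →L[ℝ] G} (hS : S ≠ 0) {cost : ℝ≥0 → ℕ+ → ℝ≥0∞}
    (hcost : IsCostFunction cost) (d : ℕ+) {ε s : ℝ≥0} (hε0 : 0 < ε) (hε : 8 * ε ≤ 1)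
    (hs : 256 * (ε : ℝ) ^ 2 ≤ (s : ℝ) ^ 2) :
    auxCost cost s d / 2 ≤ compWA (fun σ => cost σ d) S ε := by
  refine le_sInf ?_
  rintro _ ⟨N, Φ, hN, hΦ, herr, rfl⟩
  set C := costWA (fun σ => cost σ d) (Metric.closedBall (0 : F) 1) N with hC
  have hε1 : ε < 1 := by
    rw [← NNReal.coe_lt_coe]
    have : (8 * ε : ℝ) ≤ 1 := by exact_mod_cast hε
    have h0 : (0 : ℝ) < ε := hε0
    push_cast
    linarith
  have h1C : 1 ≤ C := one_le_costWA (fun σ => hcost.one_le σ d) hε1 hS herr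
  rcases eq_or_ne C ∞ with hCT | hCT
  · rw [hCT]
    exact le_top
  obtain ⟨y, n, hy, hprec⟩ := exists_cheap_precise_path hS hN hΦ
    (hcost.antitone_precision d).measurable hε0 hε herr (zero_lt_one.trans_le h1C).ne' hCT
  have hε0' : (0 : ℝ) < ε := hε0
  have hs0 : 0 < s := by
    rw [pos_iff_ne_zero]
    rintro rfl
    have : 0 < 256 * (ε : ℝ) ^ 2 := by positivity
    simp at hs
    linarith
  rw [ENNReal.div_le_iff (by simp) (by simp), mul_comm C]
  refine le_trans (auxCost_le_sum_of_precise cost hs0 d (fun i => N.σ i (initSeg y i)) n ?_) hy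
  refine hprec.imp_right fun h => le_trans ?_ h.le
  exact inv_anti₀ (by positivity) hs

end SecondBound

end NoisyInfo

theorem lemma4p1 :
    ∃ c : ℝ≥0, 0 < c ∧ c < 1 ∧
      ∀ (F G : ℕ+ → Type*)
        [∀ d, NormedAddCommGroup (F d)] [∀ d, InnerProductSpace ℝ (F d)]
        [∀ d, CompleteSpace (F d)] [∀ d, TopologicalSpace.SeparableSpace (F d)]
        [∀ d, NormedAddCommGroup (G d)] [∀ d, InnerProductSpace ℝ (G d)]
        [∀ d, CompleteSpace (G d)] [∀ d, TopologicalSpace.SeparableSpace (G d)]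
        (S : ∀ d, F d →L[ℝ] G d) (_ : ∀ d, S d ≠ 0) (_ : ∀ d, IsCompactOperator (S d))
        (cost : ℝ≥0 → ℕ+ → ℝ≥0∞) (_ : NoisyInfo.IsCostFunction cost),
        (∀ (ε : ℝ≥0) (d : ℕ+), 0 < ε → ε < 1 →
          (NoisyInfo.nWorst (S d) (2 * ε) + 1) / 4
            ≤ NoisyInfo.compWA (fun σ => cost σ d) (S d) ε) ∧
        (∀ (ε : ℝ≥0) (d : ℕ+), 0 < ε → ε < c →
          NoisyInfo.auxCost cost (ε / (c * NNReal.sqrt 2)) d / 2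
            ≤ NoisyInfo.compWA (fun σ => cost σ d) (S d) ε) := by
  -- With `c = 1/32` one has `(ε / (c√2))² = 512 ε² ≥ 256 ε²`, and `ε < c` implies `8ε ≤ 1`.
  refine ⟨1 / 32, by norm_num, ?_, ?_⟩
  · rw [← NNReal.coe_lt_coe]
    norm_num
  intro F G _ _ _ _ _ _ _ _ S hS hcomp cost hcost
  refine ⟨fun ε d h0 h1 => NoisyInfo.nWorst_add_one_div_four_le_compWA (hS d) (hcomp d)
    (fun σ => hcost.one_le σ d) h0 h1, fun ε d h0 h1 => ?_⟩
  have h1' : (ε : ℝ) < 1 / 32 := by exact_mod_cast h1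
  have h0' : (0 : ℝ) < ε := h0
  refine NoisyInfo.auxCost_div_two_le_compWA (hS d) hcost d h0 ?_ ?_
  · rw [← NNReal.coe_le_coe]
    push_cast
    linarith
  · push_cast
    rw [div_pow, mul_pow, Real.sq_sqrt (by norm_num), le_div_iff₀ (by norm_num)]
    nlinarith [sq_nonneg (ε : ℝ)]
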